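/- Let $k\ge 3$ and let $p=(p_1,\dots,p_k)$ satisfy $p_i>0$ for all $i$ and $\sum_{i=1}^k p_i=1$. Competitive continuous Knock 'em Down with parameter $p$ is the following two-player game. An allocation is a vector $x\in\mathbb{R}^k$ with $\sum_{i=1}^k x_i=0$; its clearance time is $$T_x=\max_{1\le i\le k}\left(\frac{x_i}{p_i}+\frac{Z_i}{\sqrt{p_i}}\right),$$ where $Z_1,\dots,Z_k$ are independent standard normal random variables, the same ones for both players. The payoff of allocation $x$ against allocation $y$ is $$K(x,y)=\tfrac12\bigl(\Pr[T_x<T_y]-\Pr[T_y<T_x]\bigr).$$ A mixed strategy is a Borel probability measure on $\mathbb{R}^k$ concentrated on the set of allocations, and for mixed strategies $\alpha,\beta$ one puts $K(\alpha,\beta)=\iint K(x,y)\,\alpha(dx)\,\beta(dy)$. A mixed strategy $\alpha$ is optimal if there is no mixed strategy $\beta$ with $K(\beta,\alpha)>0$. Theorem 2.5. If $\alpha$ is any optimal mixed strategy of this game, then for every $i\in\{1,\dots,k\}$ the marginal distribution of the $i$-th coordinate under $\alpha$ is absolutely continuous with respect to Lebesgue measure on $\mathbb{R}$ and has a square-integrable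 density function. -/

import Mathlib

open MeasureTheory ProbabilityTheory

namespace KnockEmDown

/-- The law of `(Z₁, …, Z_k)`: independent standard normal random variables. -/
noncomputable def noise (k : ℕ) : Measure (Fin k → ℝ) :=
  Measure.pi fun _ => gaussianReal 0 1

/-- The clearance time `T_x = max_i (x_i / p_i + Z_i / √p_i)` of the allocation `x`, as a function
of the value `z` of the vector `(Z₁, …, Z_k)`. -/
noncomputable def clearanceTime {k : ℕ} (p x z : Fin k → ℝ) : ℝ :=
  ⨆ i, (x i / p i + z i / √(p i))

/-- `Pr[x beats y] = Pr[T_x < T_y]`, both clearance times being computed from the same `Z`. -/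
noncomputable def probBeats {k : ℕ} (p x y : Fin k → ℝ) : ℝ :=
  (noise k).real {z | clearanceTime p x z < clearanceTime p y z}

/-- The payoff `K(x, y) = (Pr[x beats y] - Pr[y beats x]) / 2` of two allocations. -/
noncomputable def payoff {k : ℕ} (p x y : Fin k → ℝ) : ℝ :=
  (probBeats p x y - probBeats p y x) / 2

/-- A mixed strategy: a Borel probability measure on `ℝ^k` concentrated on the allocations, i.e.
on the vectors whose coordinates sum to `0`. -/
structure IsMixedStrategy {k : ℕ} (α : Measure (Fin k → ℝ)) : Prop where
  isProbabilityMeasure : IsProbabilityMeasure α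
  sum_eq_zero : ∀ᵐ x ∂α, ∑ i, x i = 0

/-- The payoff `K(α, β) = ∬ K(x, y) α(dx) β(dy)` of two mixed strategies. -/
noncomputable def mixedPayoff {k : ℕ} (p : Fin k → ℝ) (α β : Measure (Fin k → ℝ)) : ℝ :=
  ∫ y, ∫ x, payoff p x y ∂α ∂β

/-- `α` dominates `β` if `K(α, β) > 0`. -/
def Dominates {k : ℕ} (p : Fin k → ℝ) (α β : Measure (Fin k → ℝ)) : Prop :=
  0 < mixedPayoff p α β

/-- A mixed strategy is optimal if no mixed strategy dominates it. -/
structure IsOptimal {k : ℕ} (p : Fin k → ℝ) (α : Measure (Fin k → ℝ)) : Prop where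
  isMixedStrategy : IsMixedStrategy α
  not_dominates : ∀ β : Measure (Fin k → ℝ), IsMixedStrategy β → ¬ Dominates p β α

/-- The `i`-th one-dimensional marginal distribution. -/
noncomputable def marginal {k : ℕ} (α : Measure (Fin k → ℝ)) (i : Fin k) : Measure ℝ :=
  α.map fun x => x i

end KnockEmDown

namespace KnockEmDown

/-! Both players face the same noise, so the larger of `T_x`, `T_y` is the clearance time of `x ⊔
y`. At the index where it is attained, the player with the larger coordinate loses. Hence twice the
payoff is `∑ i, sign(y_i - x_i) q_i(x ⊔ y)`, where `q_i` is `maximizerProb` (`payoff_eq_sum`). Each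
`q_i` is smooth, in the sense of bounded first and mixed second differences, and is bounded below by
a positive constant on bounded sets.

Let `α` be optimal. Far allocations lose strictly to `α`, whereas `α`-almost every allocation breaks
even, so `α` has bounded support. Translating `α` by `w` with coordinate sum zero cannot win against
`α`. Up to a small error the loss is `∑ i, S_i(w_i) + D(w)`, where `S_i` (`shiftedSign`) is odd and
records sign changes, and `D` (the sum of the `drift`s) is additive up to second order. Since
neither `w` nor `-w` wins, this sum is itself small (`abs_sum_shiftedSign_add_drift_le`).

Three coordinates now suffice. Comparing `(t, -t, 0)`, `(t, 0, -t)` and their sum `(2t, -t, -t)`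
cancels `D` and the other two `S_i`, leaving `2 S_a(t) ≤ S_a(2t)` plus an error of order `t` times
(probability of a close pair, plus `t`). As `S_i(t)` dominates the probability that two independent
draws have `i`-th coordinates within `t`, the error is controlled by the `S_i` themselves. Dyadic
iteration gives `S_i(t) = O(t)` for `t = 2^{-n}`. A measure on the line whose pairs are within `r`
with probability `O(r)` along such scales has an `L²` density
(`absolutelyContinuous_and_lintegral_rnDeriv_sq_le`). -/

/-! ### Difference bounds for the normal distribution function -/

/-- The standard normal distribution function. -/
noncomputable def stdCDF (s : ℝ) : ℝ := (gaussianReal 0 1).real (Set.Iio s)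

lemma stdCDF_nonneg (s : ℝ) : 0 ≤ stdCDF s := measureReal_nonneg

lemma stdCDF_le_one (s : ℝ) : stdCDF s ≤ 1 := measureReal_le_one

lemma measurable_stdCDF : Measurable stdCDF :=
  Monotone.measurable fun _ _ h => measureReal_mono (Set.Iio_subset_Iio h)

lemma stdCDF_pos (s : ℝ) : 0 < stdCDF s := by
  have h : (gaussianReal 0 1) (Set.Iio s) ≠ 0 := by
    intro h0
    have := gaussianReal_absolutelyContinuous' 0 (v := 1) one_ne_zero h0
    simp at this
  exact ENNReal.toReal_pos h (measure_ne_top _ _)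

lemma hasDerivAt_stdCDF (s : ℝ) : HasDerivAt stdCDF (gaussianPDFReal 0 1 s) s := by
  have hc : Continuous (gaussianPDFReal 0 1) := by
    unfold gaussianPDFReal; fun_prop
  have h1 : stdCDF = fun s => stdCDF 0 + ∫ x in (0:ℝ)..s, gaussianPDFReal 0 1 x := by
    funext s
    have key : ∀ s, stdCDF s = ∫ x in Set.Iic s, gaussianPDFReal 0 1 x := by
      intro s
      rw [stdCDF, measureReal_def, gaussianReal_apply_eq_integral _ one_ne_zero,
        ENNReal.toReal_ofReal, integral_Iic_eq_integral_Iio]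
      exact integral_nonneg fun x => gaussianPDFReal_nonneg _ _ _
    rw [key, key, ← intervalIntegral.integral_Iic_sub_Iic
      (integrable_gaussianPDFReal 0 1).integrableOn (integrable_gaussianPDFReal 0 1).integrableOn]
    ring
  rw [h1]
  exact (intervalIntegral.integral_hasDerivAt_right (hc.intervalIntegrable _ _)
    (hc.stronglyMeasurableAtFilter _ _) hc.continuousAt).const_add _

lemma gaussianPDFReal_std_le_exp (s : ℝ) : gaussianPDFReal 0 1 s ≤ Real.exp (-(s ^ 2 / 2)) := by
  have h : (√(2 * Real.pi))⁻¹ ≤ 1 := by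
    apply inv_le_one_of_one_le₀
    rw [Real.one_le_sqrt]
    nlinarith [Real.pi_gt_three]
  have h2 : gaussianPDFReal 0 1 s = (√(2 * Real.pi))⁻¹ * Real.exp (-(s ^ 2 / 2)) := by
    simp [gaussianPDFReal, neg_div]
  rw [h2]
  exact mul_le_of_le_one_left (Real.exp_pos _).le h

lemma abs_gaussianPDFReal_std_le (s : ℝ) : |gaussianPDFReal 0 1 s| ≤ 1 := by
  rw [abs_of_nonneg (gaussianPDFReal_nonneg _ _ _)]
  exact (gaussianPDFReal_std_le_exp s).trans (Real.exp_le_one_iff.2 (by nlinarith [sq_nonneg s]))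

lemma hasDerivAt_gaussianPDFReal_std (s : ℝ) :
    HasDerivAt (gaussianPDFReal 0 1) (-s * gaussianPDFReal 0 1 s) s := by
  have h2 : gaussianPDFReal 0 1 = fun s => (√(2 * Real.pi))⁻¹ * Real.exp (-(s ^ 2 / 2)) := by
    funext s; simp [gaussianPDFReal, neg_div]
  rw [h2]
  have h3 : HasDerivAt (fun s : ℝ => -(s ^ 2 / 2)) (-s) s := by
    have := ((hasDerivAt_pow 2 s).div_const 2).neg
    refine this.congr_deriv ?_
    push_cast
    ring
  exact (h3.exp.const_mul (√(2 * Real.pi))⁻¹).congr_deriv (by ring)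

lemma abs_sub_le_of_hasDerivAt {f f' : ℝ → ℝ} {C : ℝ} (hf : ∀ s, HasDerivAt f (f' s) s)
    (hC : ∀ s, |f' s| ≤ C) (s u : ℝ) : |f (s + u) - f s| ≤ C * |u| := by
  have := Convex.norm_image_sub_le_of_norm_hasDerivWithin_le (f := f) (f' := f') (s := Set.univ)
    (x := s) (y := s + u) (fun x _ => (hf x).hasDerivWithinAt) (fun x _ => hC x) convex_univ
    (Set.mem_univ _) (Set.mem_univ _)
  simpa using this

lemma abs_gaussianPDFReal_std_sub_le (s u : ℝ) :
    |gaussianPDFReal 0 1 (s + u) - gaussianPDFReal 0 1 s| ≤ |u| := by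
  have := abs_sub_le_of_hasDerivAt (C := 1) hasDerivAt_gaussianPDFReal_std (fun s => ?_) s u
  · simpa using this
  · rw [abs_mul, abs_neg, abs_of_nonneg (gaussianPDFReal_nonneg 0 1 s)]
    -- `|s| ≤ 1 + s²/2 ≤ exp(s²/2)` absorbs the Gaussian factor, whence the Lipschitz constant 1.
    have h1 : |s| ≤ Real.exp (s ^ 2 / 2) := by
      have := Real.add_one_le_exp (s ^ 2 / 2)
      nlinarith [sq_abs s, sq_nonneg (|s| - 1)]
    calc |s| * gaussianPDFReal 0 1 s ≤ Real.exp (s ^ 2 / 2) * Real.exp (-(s ^ 2 / 2)) := by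
          gcongr
          exacts [gaussianPDFReal_nonneg _ _ _, gaussianPDFReal_std_le_exp s]
      _ = 1 := by rw [← Real.exp_add]; simp

lemma abs_stdCDF_sub_le (s u : ℝ) : |stdCDF (s + u) - stdCDF s| ≤ |u| := by
  simpa using abs_sub_le_of_hasDerivAt hasDerivAt_stdCDF abs_gaussianPDFReal_std_le s u

/-- The increment of the distribution function over `v` has as derivative an increment of the
density, which is at most `|v|`; the mean value inequality then supplies the factor `|u|`. -/
lemma abs_stdCDF_second_difference_le (s u v : ℝ) :
    |stdCDF (s + u + v) - stdCDF (s + u) - stdCDF (s + v) + stdCDF s| ≤ |u| * |v| := by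
  have := abs_sub_le_of_hasDerivAt (f := fun s => stdCDF (s + v) - stdCDF s) (C := |v|)
    (fun s => ((hasDerivAt_stdCDF (s + v)).comp_add_const s v).sub (hasDerivAt_stdCDF s))
    (fun s => abs_gaussianPDFReal_std_sub_le s v) s u
  rw [mul_comm]
  convert this using 2
  ring

/-! ### Calculus of second differences -/

/-- A family of functions bounded by `1` whose first and mixed second differences are bounded
uniformly, linearly in each increment. -/
structure SecondDifferenceBound {Z E : Type*} [SeminormedAddCommGroup E] (f : Z → E → ℝ)
    (C : ℝ) : Prop where
  nonneg : 0 ≤ C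
  abs_le_one : ∀ z m, |f z m| ≤ 1
  first : ∀ z m b, |f z (m + b) - f z m| ≤ C * ‖b‖
  second : ∀ z m b b', |f z (m + b + b') - f z (m + b) - f z (m + b') + f z m| ≤ C * ‖b‖ * ‖b'‖

lemma SecondDifferenceBound.mono {Z E : Type*} [SeminormedAddCommGroup E] {f : Z → E → ℝ}
    {C C' : ℝ} (h : SecondDifferenceBound f C) (hC : C ≤ C') : SecondDifferenceBound f C' where
  nonneg := h.nonneg.trans hC
  abs_le_one := h.abs_le_one
  first z m b := (h.first z m b).trans (by gcongr)
  second z m b b' := (h.second z m b b').trans (by gcongr)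

/-- A discrete Leibniz rule: the mixed difference of a product splits into one term for the mixed
difference of each factor and two cross terms in first differences. -/
lemma SecondDifferenceBound.mul {Z E : Type*} [SeminormedAddCommGroup E] {f g : Z → E → ℝ}
    {C C' : ℝ} (hf : SecondDifferenceBound f C) (hg : SecondDifferenceBound g C') :
    SecondDifferenceBound (fun z m => f z m * g z m) (C + 3 * C' + 2 * C * C') where
  nonneg := by have := hf.nonneg; have := hg.nonneg; positivity
  abs_le_one z m := by
    rw [abs_mul]
    exact mul_le_one₀ (hf.abs_le_one z m) (abs_nonneg _) (hg.abs_le_one z m)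
  first z m b := by
    have e : f z (m + b) * g z (m + b) - f z m * g z m
        = (f z (m + b) - f z m) * g z (m + b) + f z m * (g z (m + b) - g z m) := by ring
    have hC := hf.nonneg
    have hC' := hg.nonneg
    rw [e]
    calc _ ≤ |f z (m + b) - f z m| * |g z (m + b)| + |f z m| * |g z (m + b) - g z m| := by
          rw [← abs_mul, ← abs_mul]; exact abs_add_le _ _
      _ ≤ (C * ‖b‖) * 1 + 1 * (C' * ‖b‖) := by
          gcongr
          exacts [hf.first z m b, hg.abs_le_one _ _, hf.abs_le_one _ _, hg.first _ _ _]
      _ ≤ _ := by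
          have : 0 ≤ C' * ‖b‖ := by positivity
          have : 0 ≤ C * C' * ‖b‖ := by positivity
          linarith
  second z m b b' := by
    have hC := hf.nonneg
    have hC' := hg.nonneg
    set f0 := f z m
    set f1 := f z (m + b)
    set f2 := f z (m + b')
    set f3 := f z (m + b + b')
    set g0 := g z m
    set g1 := g z (m + b)
    set g2 := g z (m + b')
    set g3 := g z (m + b + b')
    have e : f3 * g3 - f1 * g1 - f2 * g2 + f0 * g0
        = (f3 - f1 - f2 + f0) * g3 + (f1 + f2 - f0) * (g3 - g1 - g2 + g0)
          + ((f1 - f0) * (g2 - g0) + (f2 - f0) * (g1 - g0)) := by ring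
    have hb : |f1 + f2 - f0| ≤ 3 := by
      have h0 := abs_le.1 (hf.abs_le_one z m)
      have h1 := abs_le.1 (hf.abs_le_one z (m + b))
      have h2 := abs_le.1 (hf.abs_le_one z (m + b'))
      rw [abs_le]; constructor <;> linarith [h0.1, h0.2, h1.1, h1.2, h2.1, h2.2]
    rw [e]
    calc _ ≤ |f3 - f1 - f2 + f0| * |g3| + |f1 + f2 - f0| * |g3 - g1 - g2 + g0|
          + (|f1 - f0| * |g2 - g0| + |f2 - f0| * |g1 - g0|) := by
          simp only [← abs_mul]
          exact (abs_add_le _ _).trans (add_le_add (abs_add_le _ _) (abs_add_le _ _))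
      _ ≤ (C * ‖b‖ * ‖b'‖) * 1 + 3 * (C' * ‖b‖ * ‖b'‖)
          + ((C * ‖b‖) * (C' * ‖b'‖) + (C * ‖b'‖) * (C' * ‖b‖)) := by
          gcongr
          exacts [hf.second z m b b', hg.abs_le_one _ _, hg.second _ _ _ _, hf.first _ _ _,
            hg.first _ _ _, hf.first _ _ _, hg.first _ _ _]
      _ = _ := by ring

lemma exists_secondDifferenceBound_prod {Z E ι : Type*} [SeminormedAddCommGroup E]
    (f : ι → Z → E → ℝ) (s : Finset ι) (h : ∀ i, ∃ C, SecondDifferenceBound (f i) C) :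
    ∃ C, SecondDifferenceBound (fun z m => ∏ i ∈ s, f i z m) C := by
  classical
  induction s using Finset.induction_on with
  | empty => exact ⟨0, by constructor <;> simp⟩
  | insert i s hi ih =>
    obtain ⟨C, hC⟩ := ih
    obtain ⟨C', hC'⟩ := h i
    simp_rw [Finset.prod_insert hi]
    exact ⟨_, hC'.mul hC⟩

/-- First differences cost `κ` and mixed ones `κ²`; the sum serves for both. The offset `r z` plays
no role in the bound, so it is uniform in `z` and survives integration. -/
lemma secondDifferenceBound_stdCDF {Z E : Type*} [SeminormedAddCommGroup E]
    (L : E →+ ℝ) (r : Z → ℝ) (κ : ℝ) (hκ : 0 ≤ κ) (hL : ∀ b, |L b| ≤ κ * ‖b‖) :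
    SecondDifferenceBound (fun z m => stdCDF (r z + L m)) (κ + κ * κ) where
  nonneg := by positivity
  abs_le_one z m := by rw [abs_of_nonneg (stdCDF_nonneg _)]; exact stdCDF_le_one _
  first z m b := by
    rw [map_add, ← add_assoc]
    refine (abs_stdCDF_sub_le _ _).trans ((hL b).trans ?_)
    gcongr
    nlinarith
  second z m b b' := by
    simp only [map_add, ← add_assoc]
    refine (abs_stdCDF_second_difference_le _ _ _).trans ?_
    calc |L b| * |L b'| ≤ (κ * ‖b‖) * (κ * ‖b'‖) := by gcongr <;> apply hL
      _ = κ * κ * ‖b‖ * ‖b'‖ := by ring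
      _ ≤ _ := by gcongr; linarith

lemma integral_sub_sub_add {Z : Type*} [MeasurableSpace Z] {ν : Measure Z} {a b c d : Z → ℝ}
    (ha : Integrable a ν) (hb : Integrable b ν) (hc : Integrable c ν) (hd : Integrable d ν) :
    ∫ z, (a z - b z - c z + d z) ∂ν = ∫ z, a z ∂ν - ∫ z, b z ∂ν - ∫ z, c z ∂ν + ∫ z, d z ∂ν := by
  have h1 := integral_add (f := fun z => a z - b z - c z) ((ha.sub hb).sub hc) hd
  have h2 := integral_sub (f := fun z => a z - b z) (ha.sub hb) hc
  rw [h1, h2, integral_sub ha hb]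

lemma SecondDifferenceBound.integral {Z E : Type*} [SeminormedAddCommGroup E]
    [MeasurableSpace Z] (ν : Measure Z) [IsProbabilityMeasure ν] {f : Z → E → ℝ}
    {C : ℝ} (h : SecondDifferenceBound f C) (hf : ∀ m, Measurable fun z => f z m) :
    SecondDifferenceBound (fun (_ : Unit) m => ∫ z, f z m ∂ν) C := by
  have hi : ∀ m, Integrable (fun z => f z m) ν := fun m =>
    Integrable.of_bound (hf m).aestronglyMeasurable 1 (ae_of_all _ fun z => h.abs_le_one z m)
  have hb : ∀ (F : Z → ℝ) (B : ℝ), (∀ z, |F z| ≤ B) → |∫ z, F z ∂ν| ≤ B := by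
    intro F B hB
    simpa using norm_integral_le_of_norm_le_const (μ := ν) (f := F) (ae_of_all _ hB)
  refine ⟨h.nonneg, fun _ m => hb _ _ fun z => h.abs_le_one z m, fun _ m b => ?_,
    fun _ m b b' => ?_⟩
  · rw [← integral_sub (hi _) (hi _)]
    exact hb _ _ fun z => h.first z m b
  · have e : ∫ z, (f z (m + b + b') - f z (m + b) - f z (m + b') + f z m) ∂ν
        = ∫ z, f z (m + b + b') ∂ν - ∫ z, f z (m + b) ∂ν - ∫ z, f z (m + b') ∂ν
          + ∫ z, f z m ∂ν :=
      integral_sub_sub_add (hi _) (hi _) (hi _) (hi _)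
    rw [← e]
    exact hb _ _ fun z => h.second z m b b'

/-! ### Where the clearance time is attained -/

/-- The quantity `m_l / p_l + z_l / √p_l` whose maximum over `l` is the clearance time. -/
noncomputable def score {k : ℕ} (p m z : Fin k → ℝ) (l : Fin k) : ℝ := m l / p l + z l / √(p l)

/-- The event that the clearance time of `m` is attained at `i` only. -/
def soleMaximizer {k : ℕ} (p : Fin k → ℝ) (i : Fin k) (m : Fin k → ℝ) : Set (Fin k → ℝ) :=
  {z | ∀ l, l ≠ i → score p m z l < score p m z i}

/-- The probability that the clearance time of `m` is attained at `i`. -/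
noncomputable def maximizerProb {k : ℕ} (p : Fin k → ℝ) (i : Fin k) (m : Fin k → ℝ) : ℝ :=
  (noise k).real (soleMaximizer p i m)

instance isProbabilityMeasure_noise (k : ℕ) : IsProbabilityMeasure (noise k) := by
  unfold noise; infer_instance

lemma measurable_score {k : ℕ} (p m : Fin k → ℝ) (l : Fin k) :
    Measurable fun z => score p m z l := by
  unfold score; fun_prop

lemma measurableSet_soleMaximizer {k : ℕ} (p : Fin k → ℝ) (i : Fin k) (m : Fin k → ℝ) :
    MeasurableSet (soleMaximizer p i m) := by
  have : soleMaximizer p i m = ⋂ l, ⋂ (_ : l ≠ i), {z | score p m z l < score p m z i} := by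
    ext z; simp [soleMaximizer]
  rw [this]
  exact MeasurableSet.iInter fun l => MeasurableSet.iInter fun _ =>
    measurableSet_lt (measurable_score p m l) (measurable_score p m i)

/-- Fubini: given the `i`-th coordinate, the remaining ones are still independent standard normals.
-/
lemma noise_slices {n : ℕ} (i : Fin (n + 1)) (A : Fin n → ℝ → Set ℝ)
    (hA : MeasurableSet {z : Fin (n + 1) → ℝ | ∀ j, z (i.succAbove j) ∈ A j (z i)}) :
    noise (n + 1) {z | ∀ j, z (i.succAbove j) ∈ A j (z i)}
      = ∫⁻ a, ∏ j, gaussianReal 0 1 (A j a) ∂(gaussianReal 0 1) := by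
  have mp := measurePreserving_piFinSuccAbove (fun _ : Fin (n + 1) => gaussianReal 0 1) i
  rw [noise, ← mp.symm.measure_preimage hA.nullMeasurableSet,
    Measure.prod_apply (mp.symm.measurable hA)]
  refine lintegral_congr fun a => ?_
  rw [← Measure.pi_pi]
  congr 1
  ext z
  simp [MeasurableEquiv.piFinSuccAbove_symm_apply, Fin.insertNthEquiv]

/-- The value below which `z_l` has to lie for the score at `l` to be less than that at `i`, when
`z_i = a`. -/
noncomputable def threshold {k : ℕ} (p : Fin k → ℝ) (i l : Fin k) (m : Fin k → ℝ) (a : ℝ) : ℝ :=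
  √(p l) * (a / √(p i)) + √(p l) * (m i / p i - m l / p l)

lemma score_lt_iff {k : ℕ} {p : Fin k → ℝ} (hp : ∀ i, 0 < p i) (i l : Fin k) (m z : Fin k → ℝ) :
    score p m z l < score p m z i ↔ z l < threshold p i l m (z i) := by
  have h : 0 < √(p l) := Real.sqrt_pos.2 (hp l)
  have e : threshold p i l m (z i) = √(p l) * (score p m z i - m l / p l) := by
    unfold threshold score; ring
  rw [e, ← div_lt_iff₀' h, score, lt_sub_iff_add_lt']

lemma score_le_iff {k : ℕ} {p : Fin k → ℝ} (hp : ∀ i, 0 < p i) (i l : Fin k) (m z : Fin k → ℝ) :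
    score p m z l ≤ score p m z i ↔ z l ≤ threshold p i l m (z i) := by
  have h : 0 < √(p l) := Real.sqrt_pos.2 (hp l)
  have e : threshold p i l m (z i) = √(p l) * (score p m z i - m l / p l) := by
    unfold threshold score; ring
  rw [e, ← div_le_iff₀' h, score, le_sub_iff_add_le']

lemma soleMaximizer_eq {n : ℕ} {p : Fin (n + 1) → ℝ} (hp : ∀ i, 0 < p i) (i : Fin (n + 1))
    (m : Fin (n + 1) → ℝ) :
    soleMaximizer p i m =
      {z | ∀ j, z (i.succAbove j) ∈ Set.Iio (threshold p i (i.succAbove j) m (z i))} := by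
  ext z
  simp only [soleMaximizer, Set.mem_ofPred_eq, score_lt_iff hp, Set.mem_Iio]
  refine ⟨fun h j => h _ (Fin.succAbove_ne i j), fun h l hl => ?_⟩
  obtain ⟨j, rfl⟩ := Fin.exists_succAbove_eq hl
  exact h j

lemma noise_soleMaximizer {n : ℕ} {p : Fin (n + 1) → ℝ} (hp : ∀ i, 0 < p i) (i : Fin (n + 1))
    (m : Fin (n + 1) → ℝ) :
    noise (n + 1) (soleMaximizer p i m) = ∫⁻ a, ∏ j : Fin n,
      gaussianReal 0 1 (Set.Iio (threshold p i (i.succAbove j) m a)) ∂(gaussianReal 0 1) := by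
  have h := measurableSet_soleMaximizer p i m
  rw [soleMaximizer_eq hp] at h ⊢
  exact noise_slices i (fun j a => Set.Iio (threshold p i (i.succAbove j) m a)) h

/-- Ties are null: slicing along `z_i` turns weak and strict maximality into products of closed and
open half-lines, which have equal Gaussian measure. -/
lemma noise_maximizer_diff {k : ℕ} {p : Fin k → ℝ} (hp : ∀ i, 0 < p i) (i : Fin k)
    (m : Fin k → ℝ) :
    noise k ({z | ∀ l, score p m z l ≤ score p m z i} \ soleMaximizer p i m) = 0 := by
  obtain ⟨n, rfl⟩ : ∃ n, k = n + 1 := ⟨k - 1, by have := i.pos; omega⟩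
  have hm : MeasurableSet {z | ∀ l, score p m z l ≤ score p m z i} := by
    rw [Set.ofPred_forall]
    exact MeasurableSet.iInter fun l =>
      measurableSet_le (measurable_score p m l) (measurable_score p m i)
  have e : {z | ∀ l, score p m z l ≤ score p m z i} =
      {z | ∀ j, z (i.succAbove j) ∈ Set.Iic (threshold p i (i.succAbove j) m (z i))} := by
    ext z
    simp only [Set.mem_ofPred_eq, Set.mem_Iic]
    refine ⟨fun h j => (score_le_iff hp _ _ _ _).1 (h _), fun h l => ?_⟩
    rcases eq_or_ne l i with rfl | hl
    · exact le_rfl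
    · obtain ⟨j, rfl⟩ := Fin.exists_succAbove_eq hl
      exact (score_le_iff hp _ _ _ _).2 (h j)
  rw [measure_sdiff _ (measurableSet_soleMaximizer p i m).nullMeasurableSet (measure_ne_top _ _),
    noise_soleMaximizer hp, e, 
    noise_slices i (fun j a => Set.Iic (threshold p i (i.succAbove j) m a)) (e ▸ hm)]
  · have : ∀ s, gaussianReal 0 1 (Set.Iic s) = gaussianReal 0 1 (Set.Iio s) := by
      intro s
      have := nullSingletonClass_gaussianReal (μ := 0) (v := 1) one_ne_zero
      exact measure_congr Iio_ae_eq_Iic.symm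
    simp_rw [this]
    exact tsub_self _
  · intro z hz l
    rcases eq_or_ne l i with rfl | hl
    · exact le_rfl
    · exact (hz l hl).le

lemma ae_exists_soleMaximizer {k : ℕ} [NeZero k] {p : Fin k → ℝ} (hp : ∀ i, 0 < p i)
    (m : Fin k → ℝ) : ∀ᵐ z ∂(noise k), ∃ i, z ∈ soleMaximizer p i m := by
  have h : ∀ᵐ z ∂(noise k), ∀ i,
      z ∉ {z | ∀ l, score p m z l ≤ score p m z i} \ soleMaximizer p i m :=
    ae_all_iff.2 fun i => measure_eq_zero_iff_ae_notMem.1 (noise_maximizer_diff hp i m)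
  filter_upwards [h] with z hz
  obtain ⟨i, hi⟩ := Finite.exists_max (score p m z)
  exact ⟨i, by_contra fun h' => hz i ⟨hi, h'⟩⟩

lemma measurable_prod_stdCDF {n : ℕ} (p : Fin (n + 1) → ℝ) (i : Fin (n + 1))
    (m : Fin (n + 1) → ℝ) :
    Measurable fun a => ∏ j : Fin n, stdCDF (threshold p i (i.succAbove j) m a) :=
  Finset.measurable_fun_prod _ fun j _ =>
    measurable_stdCDF.comp (by unfold threshold; fun_prop)

lemma maximizerProb_eq_integral {n : ℕ} {p : Fin (n + 1) → ℝ} (hp : ∀ i, 0 < p i)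
    (i : Fin (n + 1)) (m : Fin (n + 1) → ℝ) :
    maximizerProb p i m = ∫ a, ∏ j : Fin n, stdCDF (threshold p i (i.succAbove j) m a)
      ∂(gaussianReal 0 1) := by
  rw [maximizerProb, measureReal_def, noise_soleMaximizer hp, integral_eq_lintegral_of_nonneg_ae]
  · congr 1
    refine lintegral_congr fun a => ?_
    rw [ENNReal.ofReal_prod_of_nonneg fun _ _ => stdCDF_nonneg _]
    refine Finset.prod_congr rfl fun j _ => ?_
    rw [stdCDF, ofReal_measureReal]
  · exact ae_of_all _ fun a => Finset.prod_nonneg fun _ _ => stdCDF_nonneg _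
  · exact (measurable_prod_stdCDF p i m).aestronglyMeasurable

/-- Conditioning on `z_i = a` gives a product of normal distribution functions at points affine in
`m`, with linear part independent of `a`. -/
lemma exists_secondDifferenceBound_maximizerProb {k : ℕ} {p : Fin k → ℝ} (hp : ∀ i, 0 < p i)
    (i : Fin k) :
    ∃ C, SecondDifferenceBound (fun (_ : Unit) m => maximizerProb p i m) C := by
  obtain ⟨n, rfl⟩ : ∃ n, k = n + 1 := ⟨k - 1, by have := i.pos; omega⟩
  have h : ∀ j : Fin n, ∃ C, SecondDifferenceBound
      (fun a m => stdCDF (threshold p i (i.succAbove j) m a)) C := by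
    intro j
    set l := i.succAbove j
    let L : (Fin (n + 1) → ℝ) →+ ℝ :=
      { toFun m := √(p l) * (m i / p i - m l / p l)
        map_zero' := by simp
        map_add' x y := by simp only [Pi.add_apply]; ring }
    refine ⟨_, secondDifferenceBound_stdCDF L (fun a => √(p l) * (a / √(p i)))
      (√(p l) * (1 / p i + 1 / p l)) ?_ fun b => ?_⟩
    · have := hp i
      have := hp l
      positivity
    · have h1 : |b i / p i| ≤ ‖b‖ / p i := by
        rw [abs_div, abs_of_pos (hp i)]
        exact div_le_div_of_nonneg_right (norm_le_pi_norm b i) (hp i).le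
      have h2 : |b l / p l| ≤ ‖b‖ / p l := by
        rw [abs_div, abs_of_pos (hp l)]
        exact div_le_div_of_nonneg_right (norm_le_pi_norm b l) (hp l).le
      calc |L b| = √(p l) * |b i / p i - b l / p l| := by
            simp only [L, AddMonoidHom.coe_mk, ZeroHom.coe_mk, abs_mul,
              abs_of_nonneg (Real.sqrt_nonneg _)]
        _ ≤ √(p l) * (‖b‖ / p i + ‖b‖ / p l) := by
            gcongr
            exact (abs_sub _ _).trans (add_le_add h1 h2)
        _ = _ := by ring
  obtain ⟨C, hC⟩ := exists_secondDifferenceBound_prod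
    (fun j (a : ℝ) m => stdCDF (threshold p i (i.succAbove j) m a)) Finset.univ h
  refine ⟨C, ?_⟩
  simp_rw [maximizerProb_eq_integral hp]
  exact hC.integral (gaussianReal 0 1) (measurable_prod_stdCDF p i)

lemma maximizerProb_pos {k : ℕ} {p : Fin k → ℝ} (hp : ∀ i, 0 < p i) (i : Fin k)
    (m : Fin k → ℝ) : 0 < maximizerProb p i m := by
  obtain ⟨n, rfl⟩ : ∃ n, k = n + 1 := ⟨k - 1, by have := i.pos; omega⟩
  have hpos : ∀ a, 0 < ∏ j : Fin n, stdCDF (threshold p i (i.succAbove j) m a) := fun a =>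
    Finset.prod_pos fun _ _ => stdCDF_pos _
  rw [maximizerProb_eq_integral hp, integral_pos_iff_support_of_nonneg fun a => (hpos a).le]
  · have : Function.support (fun a => ∏ j : Fin n, stdCDF (threshold p i (i.succAbove j) m a))
        = Set.univ := Set.eq_univ_of_forall fun a => (hpos a).ne'
    rw [this]
    simp
  · refine Integrable.of_bound ?_ 1 (ae_of_all _ fun a => ?_)
    · exact (measurable_prod_stdCDF p i m).aestronglyMeasurable
    · rw [Real.norm_of_nonneg (hpos a).le]
      exact Finset.prod_le_one (fun _ _ => stdCDF_nonneg _) fun _ _ => stdCDF_le_one _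

lemma continuous_maximizerProb {k : ℕ} {p : Fin k → ℝ} (hp : ∀ i, 0 < p i) (i : Fin k) :
    Continuous (maximizerProb p i) := by
  obtain ⟨C, hC⟩ := exists_secondDifferenceBound_maximizerProb hp i
  refine (LipschitzWith.of_dist_le_mul (K := ⟨C, hC.nonneg⟩) fun x y => ?_).continuous
  have := hC.first () y (x - y)
  rwa [add_sub_cancel, ← dist_eq_norm, ← Real.dist_eq] at this

lemma exists_pos_le_maximizerProb {k : ℕ} {p : Fin k → ℝ} (hp : ∀ i, 0 < p i) (R : ℝ) :
    ∃ c > 0, ∀ i m, ‖m‖ ≤ R → c ≤ maximizerProb p i m := by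
  have h : ∀ i, ∃ c > 0, ∀ m, ‖m‖ ≤ R → c ≤ maximizerProb p i m := by
    intro i
    have hK : IsCompact (Metric.closedBall (0 : Fin k → ℝ) R) := isCompact_closedBall _ _
    obtain ⟨c, hc, h⟩ := hK.exists_forall_le' (a := 0) (continuous_maximizerProb hp i).continuousOn
      fun m _ => maximizerProb_pos hp i m
    exact ⟨c, hc, fun m hm => h m (by simpa using hm)⟩
  choose c hc h using h
  rcases isEmpty_or_nonempty (Fin k) with _ | _
  · exact ⟨1, one_pos, fun i => isEmptyElim i⟩
  · obtain ⟨i₀, hi₀⟩ := Finite.exists_min c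
    exact ⟨c i₀, hc i₀, fun i m hm => (hi₀ i).trans (h i m hm)⟩

/-! ### The payoff as a sum over coordinates -/

/-- The sign of a real number as a real number. -/
noncomputable def signum (u : ℝ) : ℝ := if 0 < u then 1 else if u < 0 then -1 else 0

lemma measurable_signum : Measurable signum :=
  Measurable.ite measurableSet_Ioi measurable_const
    (Measurable.ite measurableSet_Iio measurable_const measurable_const)

lemma signum_of_pos {u : ℝ} (h : 0 < u) : signum u = 1 := by simp [signum, h]

lemma signum_of_neg {u : ℝ} (h : u < 0) : signum u = -1 := by simp [signum, h, h.not_gt]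

lemma signum_zero : signum 0 = 0 := by simp [signum]

lemma signum_neg (u : ℝ) : signum (-u) = -signum u := by
  rcases lt_trichotomy u 0 with h | rfl | h
  · rw [signum_of_neg h, signum_of_pos (by linarith), neg_neg]
  · simp [signum_zero]
  · rw [signum_of_pos h, signum_of_neg (by linarith)]

lemma abs_signum_le_one (u : ℝ) : |signum u| ≤ 1 := by
  unfold signum; split_ifs <;> simp

lemma measurable_clearanceTime {k : ℕ} (p x : Fin k → ℝ) : Measurable (clearanceTime p x) :=
  Measurable.iSup fun i => measurable_score p x i

lemma score_le_clearanceTime {k : ℕ} (p x z : Fin k → ℝ) (i : Fin k) :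
    score p x z i ≤ clearanceTime p x z :=
  le_ciSup (f := score p x z) (Set.finite_range _).bddAbove i

lemma clearanceTime_le {k : ℕ} [NeZero k] {p x z : Fin k → ℝ} {t : ℝ}
    (h : ∀ i, score p x z i ≤ t) : clearanceTime p x z ≤ t :=
  ciSup_le h

lemma exists_score_eq_clearanceTime {k : ℕ} [NeZero k] (p x z : Fin k → ℝ) :
    ∃ i, score p x z i = clearanceTime p x z :=
  exists_eq_ciSup_of_finite (f := score p x z)

lemma score_mono {k : ℕ} {p : Fin k → ℝ} (hp : ∀ i, 0 < p i) {x y z : Fin k → ℝ} {i : Fin k}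
    (h : x i ≤ y i) : score p x z i ≤ score p y z i :=
  add_le_add_left (div_le_div_of_nonneg_right h (hp i).le) _

lemma score_lt_score {k : ℕ} {p : Fin k → ℝ} (hp : ∀ i, 0 < p i) {x y z : Fin k → ℝ} {i : Fin k}
    (h : x i < y i) : score p x z i < score p y z i :=
  add_lt_add_left (div_lt_div_of_pos_right h (hp i)) _

/-- At `i` the score of `x ⊔ y` is that of `y`; every score of `x` stays below it, strictly at `i`
by `h` and elsewhere by sole maximality. -/
lemma clearanceTime_lt_of_soleMaximizer {k : ℕ} [NeZero k] {p : Fin k → ℝ} (hp : ∀ i, 0 < p i)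
    {x y z : Fin k → ℝ} {i : Fin k} (hz : z ∈ soleMaximizer p i (x ⊔ y)) (h : x i < y i) :
    clearanceTime p x z < clearanceTime p y z := by
  obtain ⟨l, hl⟩ := exists_score_eq_clearanceTime p x z
  have hi : score p (x ⊔ y) z i = score p y z i := by simp [score, h.le]
  rw [← hl]
  refine lt_of_lt_of_le ?_ (score_le_clearanceTime p y z i)
  rcases eq_or_ne l i with rfl | hli
  · exact score_lt_score hp h
  · rw [← hi]
    exact (score_mono hp le_sup_left).trans_lt (hz l hli)

lemma clearanceTime_eq_of_soleMaximizer {k : ℕ} [NeZero k] {p : Fin k → ℝ} (hp : ∀ i, 0 < p i)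
    {x y z : Fin k → ℝ} {i : Fin k} (hz : z ∈ soleMaximizer p i (x ⊔ y)) (h : x i = y i) :
    clearanceTime p x z = clearanceTime p y z := by
  have hz' : ∀ l, score p (x ⊔ y) z l ≤ score p (x ⊔ y) z i := by
    intro l
    rcases eq_or_ne l i with rfl | hli
    · exact le_rfl
    · exact (hz l hli).le
  have hx : clearanceTime p x z = score p (x ⊔ y) z i := by
    refine le_antisymm (clearanceTime_le fun l => (score_mono hp le_sup_left).trans (hz' l)) ?_
    have : score p (x ⊔ y) z i = score p x z i := by simp [score, h]
    exact this ▸ score_le_clearanceTime p x z i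
  have hy : clearanceTime p y z = score p (x ⊔ y) z i := by
    refine le_antisymm (clearanceTime_le fun l => (score_mono hp le_sup_right).trans (hz' l)) ?_
    have : score p (x ⊔ y) z i = score p y z i := by simp [score, h]
    exact this ▸ score_le_clearanceTime p y z i
  rw [hx, hy]

lemma measurableSet_beats {k : ℕ} (p x y : Fin k → ℝ) :
    MeasurableSet {z | clearanceTime p x z < clearanceTime p y z} :=
  measurableSet_lt (measurable_clearanceTime p x) (measurable_clearanceTime p y)

/-- The payoff in terms of the index at which the larger clearance time is attained. -/
lemma payoff_eq_sum {k : ℕ} [NeZero k] {p : Fin k → ℝ} (hp : ∀ i, 0 < p i) (x y : Fin k → ℝ) :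
    payoff p x y = (∑ i, signum (y i - x i) * maximizerProb p i (x ⊔ y)) / 2 := by
  have e1 : probBeats p x y - probBeats p y x = ∫ z,
      ({z | clearanceTime p x z < clearanceTime p y z}.indicator 1 z
        - {z | clearanceTime p y z < clearanceTime p x z}.indicator 1 z : ℝ) ∂(noise k) := by
    rw [integral_sub, integral_indicator_one (measurableSet_beats p x y),
      integral_indicator_one (measurableSet_beats p y x), probBeats, probBeats]
    · exact (integrable_const (1 : ℝ)).indicator (measurableSet_beats p x y)
    · exact (integrable_const (1 : ℝ)).indicator (measurableSet_beats p y x)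
  have hint : ∀ i, Integrable (fun z => signum (y i - x i) *
      (soleMaximizer p i (x ⊔ y)).indicator (1 : (Fin k → ℝ) → ℝ) z) (noise k) := fun i =>
    ((integrable_const (1 : ℝ)).indicator (measurableSet_soleMaximizer p i _)).const_mul _
  have e2 : ∑ i, signum (y i - x i) * maximizerProb p i (x ⊔ y) = ∫ z, ∑ i,
      signum (y i - x i) * (soleMaximizer p i (x ⊔ y)).indicator (1 : (Fin k → ℝ) → ℝ) z
        ∂(noise k) := by
    rw [integral_finsetSum _ fun i _ => hint i]
    refine Finset.sum_congr rfl fun i _ => ?_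
    rw [integral_const_mul, integral_indicator_one (measurableSet_soleMaximizer p i _)]
    rfl
  rw [payoff, e1, e2]
  congr 1
  refine integral_congr_ae ?_
  filter_upwards [ae_exists_soleMaximizer hp (x ⊔ y)] with z ⟨i, hi⟩
  -- Sole maximizers are unique, so only the term of the winning index `i` survives.
  rw [Finset.sum_eq_single i]
  · rw [Set.indicator_of_mem hi]
    rcases lt_trichotomy (x i) (y i) with h | h | h
    · have := clearanceTime_lt_of_soleMaximizer hp hi h
      simp [this, this.not_gt, signum_of_pos (sub_pos.2 h)]
    · have := clearanceTime_eq_of_soleMaximizer hp hi h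
      simp [this, h, signum_zero]
    · have := clearanceTime_lt_of_soleMaximizer hp (sup_comm x y ▸ hi) h
      simp [this, this.not_gt, signum_of_neg (sub_neg.2 h)]
  · intro l _ hl
    rw [Set.indicator_of_notMem, mul_zero]
    exact fun h => lt_asymm (h i hl.symm) (hi l hl)
  · simp

/-! ### Consequences of optimality for pure and translated strategies -/

lemma probBeats_nonneg {k : ℕ} (p x y : Fin k → ℝ) : 0 ≤ probBeats p x y := measureReal_nonneg

lemma probBeats_le_one {k : ℕ} (p x y : Fin k → ℝ) : probBeats p x y ≤ 1 := measureReal_le_one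

lemma abs_payoff_le {k : ℕ} (p x y : Fin k → ℝ) : |payoff p x y| ≤ 1 / 2 := by
  have h1 := probBeats_nonneg p x y
  have h2 := probBeats_nonneg p y x
  have h3 := probBeats_le_one p x y
  have h4 := probBeats_le_one p y x
  rw [payoff, abs_le]
  constructor <;> linarith

lemma payoff_swap {k : ℕ} (p x y : Fin k → ℝ) : payoff p y x = -payoff p x y := by
  unfold payoff; ring

lemma measurable_payoff {k : ℕ} [NeZero k] {p : Fin k → ℝ} (hp : ∀ i, 0 < p i) :
    Measurable fun q : (Fin k → ℝ) × (Fin k → ℝ) => payoff p q.1 q.2 := by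
  simp_rw [payoff_eq_sum hp]
  refine (Finset.measurable_fun_sum _ fun i _ => ?_).div_const 2
  refine (measurable_signum.comp (by fun_prop)).mul ?_
  have h : Continuous fun q : (Fin k → ℝ) × (Fin k → ℝ) => q.1 ⊔ q.2 :=
    continuous_pi fun j => ((continuous_apply j).comp continuous_fst).sup
      ((continuous_apply j).comp continuous_snd)
  exact ((continuous_maximizerProb hp i).comp h).measurable

lemma integrable_payoff_left {k : ℕ} [NeZero k] {p : Fin k → ℝ} (hp : ∀ i, 0 < p i)
    (α : Measure (Fin k → ℝ)) [IsProbabilityMeasure α] (x : Fin k → ℝ) :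
    Integrable (fun y => payoff p x y) α :=
  Integrable.of_bound ((measurable_payoff hp).comp measurable_prodMk_left).aestronglyMeasurable
    (1 / 2) (ae_of_all _ fun _ => abs_payoff_le _ _ _)

lemma IsOptimal.integral_payoff_nonpos {k : ℕ} {p : Fin k → ℝ} {α : Measure (Fin k → ℝ)}
    (hα : IsOptimal p α) {x : Fin k → ℝ} (hx : ∑ i, x i = 0) : ∫ y, payoff p x y ∂α ≤ 0 := by
  have hβ : IsMixedStrategy (Measure.dirac x) :=
    ⟨inferInstance, by rw [ae_dirac_eq]; exact hx⟩
  have := hα.not_dominates _ hβ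
  simpa [Dominates, mixedPayoff] using this

/-- Translating an optimal strategy within the allocations does not make it a dominating one. -/
lemma IsOptimal.integral_payoff_add_nonpos {k : ℕ} [NeZero k] {p : Fin k → ℝ} (hp : ∀ i, 0 < p i)
    {α : Measure (Fin k → ℝ)} (hα : IsOptimal p α) {w : Fin k → ℝ} (hw : ∑ i, w i = 0) :
    ∫ q, payoff p (q.1 + w) q.2 ∂(α.prod α) ≤ 0 := by
  have := hα.isMixedStrategy.isProbabilityMeasure
  have hm : Measurable fun q : (Fin k → ℝ) × (Fin k → ℝ) => payoff p (q.1 + w) q.2 :=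
    Measurable.comp (g := fun q : (Fin k → ℝ) × (Fin k → ℝ) => payoff p q.1 q.2)
      (f := fun q : (Fin k → ℝ) × (Fin k → ℝ) => (q.1 + w, q.2)) (measurable_payoff hp)
      ((measurable_fst.add_const w).prodMk measurable_snd)
  have hi : Integrable (fun q : (Fin k → ℝ) × (Fin k → ℝ) => payoff p (q.1 + w) q.2) (α.prod α) :=
    Integrable.of_bound hm.aestronglyMeasurable (1 / 2) (ae_of_all _ fun _ => abs_payoff_le _ _ _)
  rw [integral_prod _ hi]
  refine integral_nonpos_of_ae ?_
  filter_upwards [hα.isMixedStrategy.sum_eq_zero] with x hx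
  exact hα.integral_payoff_nonpos (by simp [Finset.sum_add_distrib, hx, hw])

/-- Against an optimal strategy, almost every allocation it plays breaks even. -/
lemma IsOptimal.ae_integral_payoff_eq_zero {k : ℕ} [NeZero k] {p : Fin k → ℝ}
    (hp : ∀ i, 0 < p i) {α : Measure (Fin k → ℝ)} (hα : IsOptimal p α) :
    ∀ᵐ x ∂α, ∫ y, payoff p x y ∂α = 0 := by
  have := hα.isMixedStrategy.isProbabilityMeasure
  have hi : Integrable (fun q : (Fin k → ℝ) × (Fin k → ℝ) => payoff p q.1 q.2) (α.prod α) :=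
    Integrable.of_bound (measurable_payoff hp).aestronglyMeasurable (1 / 2)
      (ae_of_all _ fun _ => abs_payoff_le _ _ _)
  -- The payoff is antisymmetric, and a nonpositive function with integral zero vanishes almost
  -- everywhere.
  have h0 : ∫ q, payoff p q.1 q.2 ∂(α.prod α) = 0 := by
    have h1 := integral_prod_swap (μ := α) (ν := α)
      (fun q : (Fin k → ℝ) × (Fin k → ℝ) => payoff p q.1 q.2)
    have h2 : ∀ q : (Fin k → ℝ) × (Fin k → ℝ),
        payoff p q.swap.1 q.swap.2 = -payoff p q.1 q.2 := fun q => payoff_swap _ _ _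
    simp_rw [h2, integral_neg] at h1
    linarith
  rw [integral_prod _ hi] at h0
  have h3 : 0 ≤ᵐ[α] fun x => -∫ y, payoff p x y ∂α := by
    filter_upwards [hα.isMixedStrategy.sum_eq_zero] with x hx
    exact neg_nonneg.2 (hα.integral_payoff_nonpos hx)
  have h4 := (integral_eq_zero_iff_of_nonneg_ae h3 hi.integral_prod_left.neg).1
    (by rw [integral_neg, h0, neg_zero])
  filter_upwards [h4] with x hx
  simpa using hx

/-! ### Bounded support of optimal strategies -/

lemma exists_measureReal_norm_gt_le {k : ℕ} (ν : Measure (Fin k → ℝ)) [IsFiniteMeasure ν]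
    {ε : ℝ} (hε : 0 < ε) : ∃ M, 0 ≤ M ∧ ν.real {y | M < ‖y‖} ≤ ε := by
  obtain ⟨K, hK, h⟩ := isTightMeasureSet_iff_exists_isCompact_measure_compl_le.1
    (isTightMeasureSet_singleton (μ := ν)) (ENNReal.ofReal ε) (ENNReal.ofReal_pos.2 hε)
  obtain ⟨M, hM⟩ := hK.isBounded.exists_norm_le
  refine ⟨max M 0, le_max_right _ _, ENNReal.toReal_le_of_le_ofReal hε.le ?_⟩
  refine (measure_mono fun y hy hyK => ?_).trans (h ν rfl)
  exact absurd ((hM y hyK).trans (le_max_left M 0)) (not_le.2 hy)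

/-- If all coordinates were below `R`, the zero sum would force each above `-kR`. -/
lemma exists_le_coord_of_sum_eq_zero {k : ℕ} [NeZero k] {x : Fin k → ℝ} (hx : ∑ i, x i = 0)
    {R : ℝ} (hR : 0 < R) (h : k * R ≤ ‖x‖) : ∃ i, R ≤ x i := by
  by_contra! hlt
  have hk : ∀ i : Fin k, |x i| < k * R := by
    intro i
    have h1 : (1 : ℝ) ≤ k := by exact_mod_cast i.pos
    rw [abs_lt]
    constructor
    · have h2 : ∑ j ∈ Finset.univ.erase i, x j ≤ ∑ j ∈ Finset.univ.erase i, R :=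
        Finset.sum_le_sum fun j _ => (hlt j).le
      rw [Finset.sum_const, Finset.card_erase_of_mem (Finset.mem_univ i), Finset.card_univ,
        Fintype.card_fin, nsmul_eq_mul, Nat.cast_pred i.pos] at h2
      have h3 := Finset.add_sum_erase Finset.univ x (Finset.mem_univ i)
      nlinarith
    · nlinarith [hlt i]
  have hpos : (0 : ℝ) < k := Nat.cast_pos.2 (NeZero.pos k)
  have : ‖x‖ < k * R := (pi_norm_lt_iff (by positivity)).2 hk
  linarith

lemma exists_clearanceTime_lt {k : ℕ} [NeZero k] {p : Fin k → ℝ} (hp : ∀ i, 0 < p i)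
    (hsum : ∑ i, p i = 1) (M : ℝ) (hM : 0 ≤ M) :
    ∃ R, ∀ x y z : Fin k → ℝ, ∑ i, x i = 0 → R < ‖x‖ → ‖y‖ ≤ M → ‖z‖ ≤ M →
      clearanceTime p y z < clearanceTime p x z := by
  set B := ∑ l, (M / p l + M / √(p l))
  have hnn : ∀ l, 0 ≤ M / p l + M / √(p l) := fun l => by have := hp l; positivity
  have hB : ∀ l, M / p l + M / √(p l) ≤ B := fun l =>
    Finset.single_le_sum (f := fun l => M / p l + M / √(p l)) (fun l _ => hnn l)
      (Finset.mem_univ l)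
  have hB0 : 0 ≤ B := Finset.sum_nonneg fun l _ => hnn l
  -- Some `x_i` is at least `2B + 1`; noise lowers its score by at most `B`, while all scores of `y`
  -- are at most `B`.
  refine ⟨k * (2 * B + 1), fun x y z hx hR hy hz => ?_⟩
  obtain ⟨i, hi⟩ := exists_le_coord_of_sum_eq_zero hx (by positivity : 0 < 2 * B + 1) hR.le
  have hpi : p i ≤ 1 := hsum ▸ Finset.single_le_sum (fun l _ => (hp l).le) (Finset.mem_univ i)
  have hT : clearanceTime p y z ≤ B := by
    refine clearanceTime_le fun l => le_trans ?_ (hB l)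
    refine add_le_add (div_le_div_of_nonneg_right ?_ (hp l).le)
      (div_le_div_of_nonneg_right ?_ (Real.sqrt_nonneg _))
    · exact (le_abs_self _).trans ((norm_le_pi_norm y l).trans hy)
    · exact (le_abs_self _).trans ((norm_le_pi_norm z l).trans hz)
  refine hT.trans_lt (lt_of_lt_of_le ?_ (score_le_clearanceTime p x z i))
  have h1 : x i ≤ x i / p i := le_div_self (by linarith) (hp i) hpi
  have h2 : -(M / √(p i)) ≤ z i / √(p i) := by
    rw [← neg_div]
    refine div_le_div_of_nonneg_right ?_ (Real.sqrt_nonneg _)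
    exact (neg_le_neg ((norm_le_pi_norm z i).trans hz)).trans (neg_abs_le _)
  have h3 : M / √(p i) ≤ B := by
    have := hB i
    have : 0 ≤ M / p i := div_nonneg hM (hp i).le
    linarith
  unfold score
  linarith

/-- Allocations far from the origin lose against a fixed mixed strategy. -/
lemma exists_integral_payoff_neg {k : ℕ} [NeZero k] {p : Fin k → ℝ} (hp : ∀ i, 0 < p i)
    (hsum : ∑ i, p i = 1) (α : Measure (Fin k → ℝ)) [IsProbabilityMeasure α] :
    ∃ R, ∀ x : Fin k → ℝ, ∑ i, x i = 0 → R < ‖x‖ → ∫ y, payoff p x y ∂α < 0 := by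
  obtain ⟨M₁, hM₁, h₁⟩ := exists_measureReal_norm_gt_le α (ε := 1 / 8) (by norm_num)
  obtain ⟨M₂, -, h₂⟩ := exists_measureReal_norm_gt_le (noise k) (ε := 1 / 8) (by norm_num)
  obtain ⟨R, hR⟩ := exists_clearanceTime_lt hp hsum (max M₁ M₂) (hM₁.trans (le_max_left _ _))
  refine ⟨R, fun x hx hxR => ?_⟩
  have hms : ∀ M, MeasurableSet {y : Fin k → ℝ | M < ‖y‖} := fun M =>
    measurableSet_lt measurable_const measurable_norm
  -- For bounded `y` the payoff is at most `(1/8 - 7/8)/2 = -3/8`; otherwise the trivial bound is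
  -- `1/2 = -3/8 + 7/8`. The exceptional mass `1/8` keeps the average negative.
  have hpay : ∀ y, payoff p x y ≤ -(3 / 8) + {y | M₁ < ‖y‖}.indicator (fun _ => 7 / 8) y := by
    intro y
    by_cases hy : M₁ < ‖y‖
    · rw [Set.indicator_of_mem (by exact hy)]
      have := abs_le.1 (abs_payoff_le p x y)
      linarith [this.2]
    · rw [Set.indicator_of_notMem (by exact hy)]
      have hlt : ∀ z, ‖z‖ ≤ M₂ → clearanceTime p y z < clearanceTime p x z := fun z hz =>
        hR x y z hx hxR ((not_lt.1 hy).trans (le_max_left _ _)) (hz.trans (le_max_right _ _))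
      have hle : probBeats p x y ≤ 1 / 8 := by
        refine (measureReal_mono (fun z hz => ?_) (measure_ne_top _ _)).trans h₂
        by_contra hzM
        exact lt_asymm hz (hlt z (not_lt.1 hzM))
      have hge : 7 / 8 ≤ probBeats p y x := by
        have : (noise k).real {z | M₂ < ‖z‖}ᶜ ≤ probBeats p y x :=
          measureReal_mono (fun z hz => hlt z (not_lt.1 hz)) (measure_ne_top _ _)
        rw [probReal_compl_eq_one_sub (hms M₂)] at this
        linarith
      unfold payoff
      linarith
  have hi : Integrable ({y : Fin k → ℝ | M₁ < ‖y‖}.indicator fun _ => (7 / 8 : ℝ)) α :=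
    (integrable_const _).indicator (hms M₁)
  calc ∫ y, payoff p x y ∂α
      ≤ ∫ y, (-(3 / 8) + {y | M₁ < ‖y‖}.indicator (fun _ => (7 / 8 : ℝ)) y) ∂α :=
        integral_mono (integrable_payoff_left hp α x) ((integrable_const _).add hi) hpay
    _ = -(3 / 8) + α.real {y | M₁ < ‖y‖} * (7 / 8) := by
        rw [integral_add (integrable_const _) hi, integral_indicator_const _ (hms M₁)]
        simp
    _ < 0 := by linarith

lemma IsOptimal.exists_ae_norm_le {k : ℕ} [NeZero k] {p : Fin k → ℝ} (hp : ∀ i, 0 < p i)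
    (hsum : ∑ i, p i = 1) {α : Measure (Fin k → ℝ)} (hα : IsOptimal p α) :
    ∃ R, ∀ᵐ x ∂α, ‖x‖ ≤ R := by
  have := hα.isMixedStrategy.isProbabilityMeasure
  obtain ⟨R, hR⟩ := exists_integral_payoff_neg hp hsum α
  refine ⟨R, ?_⟩
  filter_upwards [hα.isMixedStrategy.sum_eq_zero, hα.ae_integral_payoff_eq_zero hp] with x hx h0
  by_contra! h
  exact (hR x hx h).ne h0

/-! ### Square-integrable densities from self-correlation -/

section Density

open Filter Topology Metric

lemma measurableSet_dist_le_and (r : ℝ) :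
    MeasurableSet {a : ℝ × ℝ × ℝ | dist a.2.1 a.1 ≤ r ∧ dist a.2.2 a.1 ≤ r} :=
  measurableSet_le (f := fun a : ℝ × ℝ × ℝ => dist a.2.1 a.1) (by fun_prop) measurable_const
    |>.inter <| measurableSet_le (f := fun a : ℝ × ℝ × ℝ => dist a.2.2 a.1) (by fun_prop)
      measurable_const

lemma measurable_measure_closedBall (μ : Measure ℝ) [SFinite μ] (r : ℝ) :
    Measurable fun t => μ (closedBall t r) := by
  have h : MeasurableSet {a : ℝ × ℝ | dist a.2 a.1 ≤ r} :=
    measurableSet_le (by fun_prop) (by fun_prop)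
  exact measurable_measure_prodMk_left h

/-- Expand the square as a measure of pairs and integrate over `t` first: both points of a pair lie
within `r` of `t` only if they are within `2r` of each other, and then only for a set of `t` of
length at most `2r`. -/
lemma lintegral_measure_closedBall_sq_le (μ : Measure ℝ) [IsFiniteMeasure μ] (r : ℝ) :
    ∫⁻ t, μ (closedBall t r) ^ 2
      ≤ (μ.prod μ) {q | dist q.1 q.2 ≤ 2 * r} * ENNReal.ofReal (2 * r) := by
  have hA := measurableSet_dist_le_and r
  have h1 : ∀ t, μ (closedBall t r) ^ 2 = (μ.prod μ) (Prod.mk t ⁻¹'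
      {a : ℝ × ℝ × ℝ | dist a.2.1 a.1 ≤ r ∧ dist a.2.2 a.1 ≤ r}) := by
    intro t
    rw [sq, ← Measure.prod_prod]
    rfl
  simp_rw [h1]
  rw [← Measure.prod_apply hA, Measure.prod_apply_symm hA]
  have hD : MeasurableSet {q : ℝ × ℝ | dist q.1 q.2 ≤ 2 * r} :=
    measurableSet_le (by fun_prop) (by fun_prop)
  calc _ ≤ ∫⁻ q, {q : ℝ × ℝ | dist q.1 q.2 ≤ 2 * r}.indicator
          (fun _ => ENNReal.ofReal (2 * r)) q ∂(μ.prod μ) := by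
        refine lintegral_mono fun q => ?_
        by_cases hq : dist q.1 q.2 ≤ 2 * r
        · rw [Set.indicator_of_mem (by exact hq), ← Real.volume_closedBall q.1 r]
          refine measure_mono fun t ht => ?_
          rw [mem_closedBall, dist_comm]
          exact ht.1
        · rw [Set.indicator_of_notMem (by exact hq), nonpos_iff_eq_zero]
          refine measure_mono_null (fun t ht => hq ?_) measure_empty
          have := dist_triangle_right q.1 q.2 t
          linarith [ht.1, ht.2]
    _ = _ := by rw [lintegral_indicator_const hD, mul_comm]

lemma lintegral_measure_closedBall_div_sq_le {μ : Measure ℝ} [IsFiniteMeasure μ] {C : ENNReal}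
    {r : ℝ} (hr : 0 < r)
    (h : (μ.prod μ) {q | dist q.1 q.2 ≤ 2 * r} ≤ C * ENNReal.ofReal (2 * r)) :
    ∫⁻ t, (μ (closedBall t r) / volume (closedBall t r)) ^ 2 ≤ C := by
  have h0 : ENNReal.ofReal (2 * r) ≠ 0 := (ENNReal.ofReal_pos.2 (by positivity)).ne'
  simp_rw [Real.volume_closedBall, div_eq_mul_inv, mul_pow]
  rw [lintegral_mul_const _ ((measurable_measure_closedBall μ r).pow_const 2)]
  calc _ ≤ (C * ENNReal.ofReal (2 * r) * ENNReal.ofReal (2 * r))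
        * (ENNReal.ofReal (2 * r))⁻¹ ^ 2 := by
        gcongr
        refine (lintegral_measure_closedBall_sq_le μ r).trans ?_
        gcongr
    _ = C := by
        rw [mul_assoc C, ← sq, mul_assoc, ← mul_pow, ENNReal.mul_inv_cancel h0 ENNReal.ofReal_ne_top,
          one_pow, mul_one]

lemma measure_mul_le_setLIntegral_cthickening (μ : Measure ℝ) [IsFiniteMeasure μ] {K : Set ℝ}
    (hK : MeasurableSet K) (r : ℝ) :
    μ K * ENNReal.ofReal (2 * r) ≤ ∫⁻ t in cthickening r K, μ (closedBall t r) := by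
  have hA : MeasurableSet {a : ℝ × ℝ | a.1 ∈ K ∧ dist a.1 a.2 ≤ r} :=
    (measurable_fst hK).inter (measurableSet_le (f := fun a : ℝ × ℝ => dist a.1 a.2)
      (by fun_prop) measurable_const)
  calc μ K * ENNReal.ofReal (2 * r)
      = ∫⁻ x, volume (Prod.mk x ⁻¹' {a : ℝ × ℝ | a.1 ∈ K ∧ dist a.1 a.2 ≤ r}) ∂μ := by
        rw [mul_comm, ← lintegral_indicator_const hK]
        refine lintegral_congr fun x => ?_
        by_cases hx : x ∈ K
        · rw [Set.indicator_of_mem hx, ← Real.volume_closedBall x r]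
          congr 1
          ext t
          simp [hx, dist_comm]
        · rw [Set.indicator_of_notMem hx]
          simp [hx]
    _ = ∫⁻ t, μ ((fun x => (x, t)) ⁻¹' {a : ℝ × ℝ | a.1 ∈ K ∧ dist a.1 a.2 ≤ r}) := by
        rw [← Measure.prod_apply hA, Measure.prod_apply_symm hA]
    _ ≤ ∫⁻ t, (cthickening r K).indicator (fun t => μ (closedBall t r)) t := by
        refine lintegral_mono fun t => ?_
        by_cases ht : t ∈ cthickening r K
        · rw [Set.indicator_of_mem ht]
          exact measure_mono fun x hx => hx.2
        · rw [Set.indicator_of_notMem ht, nonpos_iff_eq_zero]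
          refine measure_mono_null (fun x hx => ht ?_) measure_empty
          exact mem_cthickening_of_dist_le t x r K hx.1 (by rw [dist_comm]; exact hx.2)
    _ = _ := lintegral_indicator isClosed_cthickening.measurableSet _

/-- Cauchy–Schwarz on the thickening of `K`, applied to the ball averages of `μ`, whose squared `L²`
norm is at most `C`. -/
lemma measure_le_rpow_mul_rpow {μ : Measure ℝ} [IsFiniteMeasure μ] {C : ENNReal}
    {r : ℝ} (hr : 0 < r)
    (h : (μ.prod μ) {q | dist q.1 q.2 ≤ 2 * r} ≤ C * ENNReal.ofReal (2 * r))
    {K : Set ℝ} (hK : MeasurableSet K) :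
    μ K ≤ C ^ (1 / 2 : ℝ) * volume (cthickening r K) ^ (1 / 2 : ℝ) := by
  have h0 : ENNReal.ofReal (2 * r) ≠ 0 := (ENNReal.ofReal_pos.2 (by positivity)).ne'
  have hm : Measurable fun t => μ (closedBall t r) / volume (closedBall t r) := by
    simp_rw [Real.volume_closedBall]
    exact (measurable_measure_closedBall μ r).div_const _
  have h1 : μ K ≤ ∫⁻ t in cthickening r K, μ (closedBall t r) / volume (closedBall t r) := by
    simp_rw [Real.volume_closedBall, div_eq_mul_inv]
    rw [lintegral_mul_const _ (measurable_measure_closedBall μ r), ← div_eq_mul_inv,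
      ENNReal.le_div_iff_mul_le (Or.inl h0) (Or.inl ENNReal.ofReal_ne_top)]
    exact measure_mul_le_setLIntegral_cthickening μ hK r
  refine h1.trans ?_
  have h2 := ENNReal.lintegral_mul_le_Lp_mul_Lq (volume.restrict (cthickening r K))
    Real.HolderConjugate.two_two hm.aemeasurable (aemeasurable_const (b := (1 : ENNReal)))
  simp only [Pi.mul_apply, mul_one, one_pow, lintegral_const, one_mul,
    Measure.restrict_apply_univ, ENNReal.rpow_two] at h2
  refine h2.trans ?_
  gcongr
  exact (setLIntegral_le_lintegral _ _).trans (lintegral_measure_closedBall_div_sq_le hr h)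

/-- A finite measure on the line whose self-correlation at small scales is at most linear in the
scale has a square-integrable density. -/
lemma absolutelyContinuous_and_lintegral_rnDeriv_sq_le {μ : Measure ℝ} [IsFiniteMeasure μ]
    {C : ENNReal} (hC : C ≠ ⊤) {r : ℕ → ℝ} (hr : ∀ n, 0 < r n) (hr0 : Tendsto r atTop (𝓝 0))
    (h : ∀ n, (μ.prod μ) {q | dist q.1 q.2 ≤ 2 * r n} ≤ C * ENNReal.ofReal (2 * r n)) :
    μ ≪ volume ∧ ∫⁻ t, (μ.rnDeriv volume t) ^ 2 ≤ C := by
  constructor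
  -- By inner regularity null compact sets suffice; the volumes of their thickenings tend to zero
  -- with `r n`.
  · refine Measure.AbsolutelyContinuous.mk fun s hs h0 => ?_
    rw [hs.measure_eq_iSup_isCompact]
    simp only [ENNReal.iSup_eq_zero]
    intro K hKs hK
    have hK0 : volume K = 0 := measure_mono_null hKs h0
    have hlim : Tendsto (fun n => C ^ (1 / 2 : ℝ) * volume (cthickening (r n) K) ^ (1 / 2 : ℝ))
        atTop (𝓝 (C ^ (1 / 2 : ℝ) * volume K ^ (1 / 2 : ℝ))) := by
      refine ENNReal.Tendsto.const_mul ?_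
        (Or.inr (ENNReal.rpow_ne_top_of_nonneg (by norm_num) hC))
      exact ((ENNReal.continuous_rpow_const).tendsto _).comp
        ((tendsto_measure_cthickening_of_isCompact hK).comp hr0)
    rw [hK0, ENNReal.zero_rpow_of_pos (by norm_num), mul_zero] at hlim
    exact le_antisymm (ge_of_tendsto' hlim fun n =>
      measure_le_rpow_mul_rpow (hr n) (h n) hK.measurableSet) bot_le
  · have hr' : Tendsto r atTop (𝓝[>] 0) :=
      tendsto_nhdsWithin_iff.2 ⟨hr0, Eventually.of_forall hr⟩
    have hlim : ∀ᵐ t, Tendsto (fun n =>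
        (μ (closedBall t (r n)) / volume (closedBall t (r n))) ^ 2) atTop
        (𝓝 (μ.rnDeriv volume t ^ 2)) := by
      filter_upwards [Besicovitch.ae_tendsto_rnDeriv μ volume] with t ht
      exact ((ENNReal.continuous_pow 2).tendsto _).comp (ht.comp hr')
    -- Ball averages converge almost everywhere to the density, so Fatou transfers their `L²` bound.
    calc ∫⁻ t, (μ.rnDeriv volume t) ^ 2
        = ∫⁻ t, liminf (fun n =>
          (μ (closedBall t (r n)) / volume (closedBall t (r n))) ^ 2) atTop := by
          refine lintegral_congr_ae ?_
          filter_upwards [hlim] with t ht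
          exact ht.liminf_eq.symm
      _ ≤ liminf (fun n => ∫⁻ t,
          (μ (closedBall t (r n)) / volume (closedBall t (r n))) ^ 2) atTop := by
          refine lintegral_liminf_le fun n => ?_
          simp_rw [Real.volume_closedBall]
          exact ((measurable_measure_closedBall μ (r n)).div_const _).pow_const 2
      _ ≤ C := by
          refine (liminf_le_liminf (Eventually.of_forall fun n =>
            lintegral_measure_closedBall_div_sq_le (hr n) (h n))).trans ?_
          simp

lemma exists_memLp_two_density {μ : Measure ℝ} [IsFiniteMeasure μ] (hac : μ ≪ volume)
    (h : ∫⁻ t, (μ.rnDeriv volume t) ^ 2 ≠ ⊤) :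
    ∃ f : ℝ → ℝ, Measurable f ∧ (∀ t, 0 ≤ f t) ∧
      μ = volume.withDensity (fun t => ENNReal.ofReal (f t)) ∧ MemLp f 2 volume := by
  have hm : Measurable fun t => (μ.rnDeriv volume t).toReal :=
    (Measure.measurable_rnDeriv μ volume).ennreal_toReal
  have hae : ∀ᵐ t, ENNReal.ofReal (μ.rnDeriv volume t).toReal = μ.rnDeriv volume t := by
    filter_upwards [Measure.rnDeriv_lt_top μ volume] with t ht
    exact ENNReal.ofReal_toReal ht.ne
  refine ⟨fun t => (μ.rnDeriv volume t).toReal, hm, fun t => ENNReal.toReal_nonneg, ?_, ?_⟩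
  · rw [withDensity_congr_ae hae, Measure.withDensity_rnDeriv_eq _ _ hac]
  · rw [memLp_two_iff_integrable_sq hm.aestronglyMeasurable]
    refine ⟨(hm.pow_const 2).aestronglyMeasurable, ?_⟩
    rw [hasFiniteIntegral_iff_ofReal (ae_of_all _ fun t => sq_nonneg _)]
    refine lt_of_le_of_lt (le_of_eq (lintegral_congr_ae ?_)) h.lt_top
    filter_upwards [hae] with t ht
    rw [ENNReal.ofReal_pow ENNReal.toReal_nonneg, ht]

end Density

/-! ### Expansion of the loss under a translation -/

/-- The average of the sign of `x_i - y_i + t`, weighted by the probability that the clearance time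
of `x ⊔ y` is attained at `i`, for independent `x`, `y` with law `α`. -/
noncomputable def shiftedSign {k : ℕ} (p : Fin k → ℝ) (α : Measure (Fin k → ℝ)) (i : Fin k)
    (t : ℝ) : ℝ :=
  ∫ a, signum (a.1 i - a.2 i + t) * maximizerProb p i (a.1 ⊔ a.2) ∂(α.prod α)

/-- The part of the increment `w` that acts on `x ⊔ y` when `x` moves to `x + w` and no coordinate
of `x` passes the one of `y`. -/
noncomputable def effectiveShift {k : ℕ} (w : Fin k → ℝ) (a : (Fin k → ℝ) × (Fin k → ℝ)) :
    Fin k → ℝ :=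
  fun j => if a.2 j < a.1 j then w j else 0

/-- The contribution of index `i` to the payoff under the effective shift, signs being kept. -/
noncomputable def drift {k : ℕ} (p : Fin k → ℝ) (α : Measure (Fin k → ℝ)) (i : Fin k)
    (w : Fin k → ℝ) : ℝ :=
  ∫ a, signum (a.1 i - a.2 i) * maximizerProb p i (a.1 ⊔ a.2 + effectiveShift w a) ∂(α.prod α)

/-- The contribution of index `i` to the loss of `α` shifted by `w` against `α`. -/
noncomputable def shiftLoss {k : ℕ} (p : Fin k → ℝ) (α : Measure (Fin k → ℝ)) (i : Fin k)
    (w : Fin k → ℝ) : ℝ :=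
  ∫ a, signum (a.1 i - a.2 i + w i) * maximizerProb p i ((a.1 + w) ⊔ a.2) ∂(α.prod α)

/-- The pairs of allocations that have a coordinate at distance at most `r`. -/
def closePairs (k : ℕ) (r : ℝ) : Set ((Fin k → ℝ) × (Fin k → ℝ)) :=
  {a | ∃ j, |a.1 j - a.2 j| ≤ r}

lemma measurable_maximizerProb {k : ℕ} {p : Fin k → ℝ} (hp : ∀ i, 0 < p i) (i : Fin k) :
    Measurable (maximizerProb p i) := (continuous_maximizerProb hp i).measurable

lemma maximizerProb_nonneg {k : ℕ} (p : Fin k → ℝ) (i : Fin k) (m : Fin k → ℝ) :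
    0 ≤ maximizerProb p i m := measureReal_nonneg

lemma maximizerProb_le_one {k : ℕ} (p : Fin k → ℝ) (i : Fin k) (m : Fin k → ℝ) :
    maximizerProb p i m ≤ 1 := measureReal_le_one

lemma abs_signum_mul_maximizerProb_le {k : ℕ} (p : Fin k → ℝ) (i : Fin k) (u : ℝ)
    (m : Fin k → ℝ) : |signum u * maximizerProb p i m| ≤ 1 := by
  rw [abs_mul, abs_of_nonneg (maximizerProb_nonneg p i m)]
  exact mul_le_one₀ (abs_signum_le_one u) (maximizerProb_nonneg p i m) (maximizerProb_le_one p i m)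

lemma integrable_signum_mul_maximizerProb {Z : Type*} [MeasurableSpace Z] {ν : Measure Z}
    [IsFiniteMeasure ν] {k : ℕ} {p : Fin k → ℝ} (hp : ∀ i, 0 < p i) (i : Fin k) {f : Z → ℝ}
    {g : Z → Fin k → ℝ} (hf : Measurable f) (hg : Measurable g) :
    Integrable (fun a => signum (f a) * maximizerProb p i (g a)) ν :=
  Integrable.of_bound ((measurable_signum.comp hf).mul
    ((measurable_maximizerProb hp i).comp hg)).aestronglyMeasurable 1
    (ae_of_all _ fun _ => abs_signum_mul_maximizerProb_le _ _ _ _)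

lemma measurable_sup_pair (k : ℕ) :
    Measurable fun a : (Fin k → ℝ) × (Fin k → ℝ) => a.1 ⊔ a.2 :=
  measurable_pi_lambda _ fun j =>
    ((measurable_pi_apply j).comp measurable_fst).max ((measurable_pi_apply j).comp measurable_snd)

lemma measurable_add_sup_pair {k : ℕ} (w : Fin k → ℝ) :
    Measurable fun a : (Fin k → ℝ) × (Fin k → ℝ) => (a.1 + w) ⊔ a.2 :=
  measurable_pi_lambda _ fun j =>
    (((measurable_pi_apply j).comp measurable_fst).add measurable_const).max
      ((measurable_pi_apply j).comp measurable_snd)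

lemma measurable_coord_sub {k : ℕ} (i : Fin k) :
    Measurable fun a : (Fin k → ℝ) × (Fin k → ℝ) => a.1 i - a.2 i := by
  fun_prop

lemma measurable_effectiveShift {k : ℕ} (w : Fin k → ℝ) : Measurable (effectiveShift w) :=
  measurable_pi_lambda _ fun _ =>
    Measurable.ite (measurableSet_lt (by fun_prop) (by fun_prop)) measurable_const measurable_const

lemma measurable_sup_add_effectiveShift {k : ℕ} (w : Fin k → ℝ) :
    Measurable fun a : (Fin k → ℝ) × (Fin k → ℝ) => a.1 ⊔ a.2 + effectiveShift w a :=
  (measurable_sup_pair k).add (measurable_effectiveShift w)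

lemma effectiveShift_zero {k : ℕ} (a : (Fin k → ℝ) × (Fin k → ℝ)) : effectiveShift 0 a = 0 := by
  ext; simp [effectiveShift]

/-- Additivity is the reason for freezing the order of the coordinates: the true increment of `x ⊔
y` is not additive in `w`. -/
lemma effectiveShift_add {k : ℕ} (w w' : Fin k → ℝ) (a : (Fin k → ℝ) × (Fin k → ℝ)) :
    effectiveShift (w + w') a = effectiveShift w a + effectiveShift w' a := by
  ext j
  simp only [effectiveShift, Pi.add_apply]
  split_ifs <;> simp

lemma norm_effectiveShift_le {k : ℕ} (w : Fin k → ℝ) (a : (Fin k → ℝ) × (Fin k → ℝ)) :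
    ‖effectiveShift w a‖ ≤ ‖w‖ := by
  refine (pi_norm_le_iff_of_nonneg (norm_nonneg _)).2 fun j => ?_
  unfold effectiveShift
  split_ifs
  · exact norm_le_pi_norm w j
  · simp

lemma measurableSet_closePairs (k : ℕ) (r : ℝ) : MeasurableSet (closePairs k r) := by
  have : closePairs k r = ⋃ j, {a | |a.1 j - a.2 j| ≤ r} := by ext; simp [closePairs]
  rw [this]
  exact MeasurableSet.iUnion fun j => measurableSet_le (measurable_coord_sub j).abs measurable_const

lemma norm_add_sup_sub_sup_le {k : ℕ} (x y w : Fin k → ℝ) : ‖(x + w) ⊔ y - x ⊔ y‖ ≤ ‖w‖ := by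
  refine (pi_norm_le_iff_of_nonneg (norm_nonneg _)).2 fun j => ?_
  simp only [Pi.sub_apply, Pi.sup_apply, Pi.add_apply, Real.norm_eq_abs]
  refine (abs_max_sub_max_le_abs _ _ _).trans ?_
  rw [add_sub_cancel_left]
  exact norm_le_pi_norm w j

lemma sup_add_effectiveShift_eq {k : ℕ} {w : Fin k → ℝ} {a : (Fin k → ℝ) × (Fin k → ℝ)}
    (ha : a ∉ closePairs k ‖w‖) : a.1 ⊔ a.2 + effectiveShift w a = (a.1 + w) ⊔ a.2 := by
  ext j
  have hj : ‖w‖ < |a.1 j - a.2 j| := by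
    by_contra! h
    exact ha ⟨j, h⟩
  have hw := abs_le.1 (norm_le_pi_norm w j)
  simp only [effectiveShift, Pi.add_apply, Pi.sup_apply]
  split_ifs with h
  · rw [abs_of_pos (sub_pos.2 h)] at hj
    rw [max_eq_left h.le, max_eq_left (by linarith [hw.1])]
  · rw [abs_of_nonpos (sub_nonpos.2 (not_lt.1 h))] at hj
    rw [max_eq_right (not_lt.1 h), max_eq_right (by linarith [hw.2]), add_zero]

lemma signum_add_eq {u v : ℝ} (h : |v| < |u|) : signum (u + v) = signum u := by
  have hv := abs_lt.1 h
  rcases lt_trichotomy u 0 with hu | rfl | hu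
  · rw [abs_of_neg hu] at hv
    rw [signum_of_neg hu, signum_of_neg (by linarith [hv.2])]
  · simp at hv
    linarith [hv.1, hv.2]
  · rw [abs_of_pos hu] at hv
    rw [signum_of_pos hu, signum_of_pos (by linarith [hv.1])]

lemma measureReal_closePairs_le {k : ℕ} {α : Measure (Fin k → ℝ)} (r : ℝ) :
    (α.prod α).real (closePairs k r) ≤ ∑ j, (α.prod α).real {a | |a.1 j - a.2 j| ≤ r} := by
  have : closePairs k r = ⋃ j, {a | |a.1 j - a.2 j| ≤ r} := by ext; simp [closePairs]
  rw [this]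
  exact measureReal_iUnion_fintype_le _

section Estimates

variable {k : ℕ} {p : Fin k → ℝ} {α : Measure (Fin k → ℝ)} [IsProbabilityMeasure α]

lemma shiftedSign_neg (i : Fin k) (t : ℝ) : shiftedSign p α i (-t) = -shiftedSign p α i t := by
  rw [shiftedSign, shiftedSign, ← integral_prod_swap, ← integral_neg]
  congr 1
  funext a
  rw [Prod.fst_swap, Prod.snd_swap, sup_comm, ← neg_mul, ← signum_neg]
  congr 2
  ring

lemma shiftedSign_zero (i : Fin k) : shiftedSign p α i 0 = 0 := by
  have := shiftedSign_neg (p := p) (α := α) i 0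
  rw [neg_zero] at this
  linarith

lemma drift_zero (i : Fin k) : drift p α i 0 = 0 := by
  rw [← shiftedSign_zero (p := p) (α := α) i, drift, shiftedSign]
  simp_rw [effectiveShift_zero, add_zero]

/-- As `drift` vanishes at `0`, the left side is a mixed second difference, with increments the
effective shifts of `w` and `w'`. -/
lemma abs_drift_add_sub_le (hp : ∀ i, 0 < p i) {i : Fin k} {C : ℝ}
    (hC : SecondDifferenceBound (fun (_ : Unit) m => maximizerProb p i m) C) (w w' : Fin k → ℝ) :
    |drift p α i (w + w') - drift p α i w - drift p α i w'| ≤ C * ‖w‖ * ‖w'‖ := by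
  have hi : ∀ w, Integrable (fun a : (Fin k → ℝ) × (Fin k → ℝ) => signum (a.1 i - a.2 i) *
      maximizerProb p i (a.1 ⊔ a.2 + effectiveShift w a)) (α.prod α) := fun w =>
    integrable_signum_mul_maximizerProb hp i (measurable_coord_sub i)
      (measurable_sup_add_effectiveShift w)
  have e := integral_sub_sub_add (hi (w + w')) (hi w) (hi w') (hi 0)
  have e' : drift p α i (w + w') - drift p α i w - drift p α i w' =
      drift p α i (w + w') - drift p α i w - drift p α i w' + drift p α i 0 := by
    rw [drift_zero, add_zero]
  rw [e']
  unfold drift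
  rw [← e]
  have hb := norm_integral_le_of_norm_le_const (μ := α.prod α) (C := C * ‖w‖ * ‖w'‖)
    (f := fun a : (Fin k → ℝ) × (Fin k → ℝ) =>
      signum (a.1 i - a.2 i) * maximizerProb p i (a.1 ⊔ a.2 + effectiveShift (w + w') a)
      - signum (a.1 i - a.2 i) * maximizerProb p i (a.1 ⊔ a.2 + effectiveShift w a)
      - signum (a.1 i - a.2 i) * maximizerProb p i (a.1 ⊔ a.2 + effectiveShift w' a)
      + signum (a.1 i - a.2 i) * maximizerProb p i (a.1 ⊔ a.2 + effectiveShift 0 a))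
    (ae_of_all _ fun a => ?_)
  · simpa using hb
  · rw [← mul_sub, ← mul_sub, ← mul_add, Real.norm_eq_abs, abs_mul, effectiveShift_zero, add_zero,
      effectiveShift_add, ← add_assoc]
    have hCn := hC.nonneg
    calc _ ≤ 1 * (C * ‖effectiveShift w a‖ * ‖effectiveShift w' a‖) :=
          mul_le_mul (abs_signum_le_one _) (hC.second () _ _ _) (abs_nonneg _) zero_le_one
      _ ≤ C * ‖w‖ * ‖w'‖ := by
          rw [one_mul]
          gcongr <;> apply norm_effectiveShift_le

/-- Off the close pairs no coordinate of `x` passes that of `y`, and the integrand of the difference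
vanishes identically. On close pairs it consists of two first differences of `maximizerProb`, each
at most `C * ‖w‖`. -/
lemma abs_shiftLoss_sub_le (hp : ∀ i, 0 < p i) {i : Fin k} {C : ℝ}
    (hC : SecondDifferenceBound (fun (_ : Unit) m => maximizerProb p i m) C) (w : Fin k → ℝ) :
    |shiftLoss p α i w - shiftedSign p α i (w i) - drift p α i w|
      ≤ 2 * C * ‖w‖ * (α.prod α).real (closePairs k ‖w‖) := by
  have hd : ∀ w, Integrable (fun a : (Fin k → ℝ) × (Fin k → ℝ) => signum (a.1 i - a.2 i) *
      maximizerProb p i (a.1 ⊔ a.2 + effectiveShift w a)) (α.prod α) := fun w =>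
    integrable_signum_mul_maximizerProb hp i (measurable_coord_sub i)
      (measurable_sup_add_effectiveShift w)
  have hl : Integrable (fun a : (Fin k → ℝ) × (Fin k → ℝ) => signum (a.1 i - a.2 i + w i) *
      maximizerProb p i ((a.1 + w) ⊔ a.2)) (α.prod α) :=
    integrable_signum_mul_maximizerProb hp i ((measurable_coord_sub i).add_const _)
      (measurable_add_sup_pair w)
  have hs : Integrable (fun a : (Fin k → ℝ) × (Fin k → ℝ) => signum (a.1 i - a.2 i + w i) *
      maximizerProb p i (a.1 ⊔ a.2)) (α.prod α) :=
    integrable_signum_mul_maximizerProb hp i ((measurable_coord_sub i).add_const _)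
      (measurable_sup_pair k)
  have e := integral_sub_sub_add hl hs (hd w) (hd 0)
  have e' : shiftLoss p α i w - shiftedSign p α i (w i) - drift p α i w =
      shiftLoss p α i w - shiftedSign p α i (w i) - drift p α i w + drift p α i 0 := by
    rw [drift_zero, add_zero]
  rw [e']
  unfold drift shiftLoss shiftedSign
  rw [← e]
  have hCn := hC.nonneg
  have hI : Integrable ((closePairs k ‖w‖).indicator fun _ => 2 * C * ‖w‖) (α.prod α) :=
    (integrable_const _).indicator (measurableSet_closePairs k _)
  have hb := norm_integral_le_of_norm_le hI (f := fun a : (Fin k → ℝ) × (Fin k → ℝ) =>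
      signum (a.1 i - a.2 i + w i) * maximizerProb p i ((a.1 + w) ⊔ a.2)
      - signum (a.1 i - a.2 i + w i) * maximizerProb p i (a.1 ⊔ a.2)
      - signum (a.1 i - a.2 i) * maximizerProb p i (a.1 ⊔ a.2 + effectiveShift w a)
      + signum (a.1 i - a.2 i) * maximizerProb p i (a.1 ⊔ a.2 + effectiveShift 0 a))
    (ae_of_all _ fun a => ?_)
  · rw [integral_indicator_const _ (measurableSet_closePairs k _), smul_eq_mul, mul_comm] at hb
    exact hb
  · rw [effectiveShift_zero, add_zero, Real.norm_eq_abs]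
    by_cases ha : a ∈ closePairs k ‖w‖
    · rw [Set.indicator_of_mem ha]
      have h1 : |maximizerProb p i ((a.1 + w) ⊔ a.2) - maximizerProb p i (a.1 ⊔ a.2)|
          ≤ C * ‖w‖ := by
        have := hC.first () (a.1 ⊔ a.2) ((a.1 + w) ⊔ a.2 - a.1 ⊔ a.2)
        rw [add_sub_cancel] at this
        refine this.trans ?_
        gcongr
        exact norm_add_sup_sub_sup_le _ _ _
      have h2 : |maximizerProb p i (a.1 ⊔ a.2 + effectiveShift w a)
          - maximizerProb p i (a.1 ⊔ a.2)| ≤ C * ‖w‖ := by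
        refine (hC.first () (a.1 ⊔ a.2) (effectiveShift w a)).trans ?_
        gcongr
        exact norm_effectiveShift_le _ _
      calc _ = |signum (a.1 i - a.2 i + w i) *
              (maximizerProb p i ((a.1 + w) ⊔ a.2) - maximizerProb p i (a.1 ⊔ a.2))
            - signum (a.1 i - a.2 i) * (maximizerProb p i (a.1 ⊔ a.2 + effectiveShift w a)
              - maximizerProb p i (a.1 ⊔ a.2))| := by
            congr 1; ring
        _ ≤ 1 * (C * ‖w‖) + 1 * (C * ‖w‖) := by
            refine (abs_sub _ _).trans (add_le_add ?_ ?_) <;> rw [abs_mul]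
            · exact mul_le_mul (abs_signum_le_one _) h1 (abs_nonneg _) zero_le_one
            · exact mul_le_mul (abs_signum_le_one _) h2 (abs_nonneg _) zero_le_one
        _ = _ := by ring
    · rw [Set.indicator_of_notMem ha, sup_add_effectiveShift_eq ha, signum_add_eq]
      · simp
      · by_contra! h
        exact ha ⟨i, h.trans (norm_le_pi_norm w i)⟩

/-- By oddness the right side integrates `sign(u + t) - sign(u - t)`, with `u = a.1 i - a.2 i`,
against a weight at least `c`. This difference is at least 1 when `|u| ≤ t` (exactly 1 at the
endpoints) and 0 otherwise. -/
lemma mul_measureReal_le_shiftedSign (hp : ∀ i, 0 < p i) {c R : ℝ}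
    (hc : ∀ i m, ‖m‖ ≤ R → c ≤ maximizerProb p i m) (hR : ∀ᵐ x ∂α, ‖x‖ ≤ R) (i : Fin k) {t : ℝ}
    (ht : 0 < t) : c * (α.prod α).real {a | |a.1 i - a.2 i| ≤ t} ≤ 2 * shiftedSign p α i t := by
  have hs : ∀ t, Integrable (fun a : (Fin k → ℝ) × (Fin k → ℝ) => signum (a.1 i - a.2 i + t) *
      maximizerProb p i (a.1 ⊔ a.2)) (α.prod α) := fun t =>
    integrable_signum_mul_maximizerProb hp i ((measurable_coord_sub i).add_const _)
      (measurable_sup_pair k)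
  have hm : MeasurableSet {a : (Fin k → ℝ) × (Fin k → ℝ) | |a.1 i - a.2 i| ≤ t} :=
    measurableSet_le (measurable_coord_sub i).abs measurable_const
  have e : 2 * shiftedSign p α i t = shiftedSign p α i t - shiftedSign p α i (-t) := by
    rw [shiftedSign_neg]; ring
  rw [e, shiftedSign, shiftedSign, ← integral_sub (hs t) (hs (-t)), mul_comm, ← smul_eq_mul,
    ← integral_indicator_const _ hm]
  refine integral_mono_ae ((integrable_const c).indicator hm) ((hs t).sub (hs (-t))) ?_
  have h1 : ∀ᵐ a ∂(α.prod α), ‖a.1‖ ≤ R := Measure.quasiMeasurePreserving_fst.ae hR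
  have h2 : ∀ᵐ a ∂(α.prod α), ‖a.2‖ ≤ R := Measure.quasiMeasurePreserving_snd.ae hR
  filter_upwards [h1, h2] with a ha1 ha2
  have hsup : ‖a.1 ⊔ a.2‖ ≤ R := by
    refine (pi_norm_le_iff_of_nonneg ((norm_nonneg _).trans ha1)).2 fun j => ?_
    exact abs_max_le_max_abs_abs.trans
      (max_le ((norm_le_pi_norm a.1 j).trans ha1) ((norm_le_pi_norm a.2 j).trans ha2))
  have hq := hc i _ hsup
  have hq0 := maximizerProb_nonneg p i (a.1 ⊔ a.2)
  rw [← sub_mul]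
  set u := a.1 i - a.2 i with hu
  by_cases h : |u| ≤ t
  · rw [Set.indicator_of_mem (by exact h)]
    have h' := abs_le.1 h
    have : 1 ≤ signum (u + t) - signum (u + -t) := by
      unfold signum
      split_ifs <;> linarith
    nlinarith
  · rw [Set.indicator_of_notMem (by exact h)]
    rw [signum_add_eq (by rw [abs_of_pos ht]; linarith),
      signum_add_eq (by rw [abs_neg, abs_of_pos ht]; linarith), sub_self, zero_mul]

end Estimates

/-! ### First-order condition at an optimal strategy -/

lemma IsOptimal.sum_shiftLoss_nonneg {k : ℕ} [NeZero k] {p : Fin k → ℝ} (hp : ∀ i, 0 < p i)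
    {α : Measure (Fin k → ℝ)} (hα : IsOptimal p α) {w : Fin k → ℝ} (hw : ∑ i, w i = 0) :
    0 ≤ ∑ i, shiftLoss p α i w := by
  have := hα.isMixedStrategy.isProbabilityMeasure
  have hl : ∀ i, Integrable (fun a : (Fin k → ℝ) × (Fin k → ℝ) => signum (a.1 i - a.2 i + w i) *
      maximizerProb p i ((a.1 + w) ⊔ a.2)) (α.prod α) := fun i =>
    integrable_signum_mul_maximizerProb hp i ((measurable_coord_sub i).add_const _)
      (measurable_add_sup_pair w)
  have h := hα.integral_payoff_add_nonpos hp hw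
  have e : ∑ i, shiftLoss p α i w = -2 * ∫ q, payoff p (q.1 + w) q.2 ∂(α.prod α) := by
    unfold shiftLoss
    rw [← integral_finsetSum _ fun i _ => hl i, ← integral_const_mul]
    congr 1
    funext a
    rw [payoff_eq_sum hp, mul_div_assoc', neg_mul, neg_div, mul_div_cancel_left₀ _ two_ne_zero,
      ← Finset.sum_neg_distrib]
    refine Finset.sum_congr rfl fun i _ => ?_
    rw [← neg_mul, ← signum_neg]
    congr 2
    simp only [Pi.add_apply]
    ring
  rw [e]
  linarith

/-- To first order, the loss from shifting an optimal strategy vanishes. -/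
lemma IsOptimal.abs_sum_shiftedSign_add_drift_le {k : ℕ} [NeZero k] {p : Fin k → ℝ}
    (hp : ∀ i, 0 < p i) {α : Measure (Fin k → ℝ)} (hα : IsOptimal p α) {C : ℝ}
    (hC : ∀ i, SecondDifferenceBound (fun (_ : Unit) m => maximizerProb p i m) C)
    {w : Fin k → ℝ} (hw : ∑ i, w i = 0) {r : ℝ} (hr : ‖w‖ ≤ r) :
    |∑ i, shiftedSign p α i (w i) + ∑ i, drift p α i w|
      ≤ k * (2 * C * r * (α.prod α).real (closePairs k r) + C * r * r) := by
  have := hα.isMixedStrategy.isProbabilityMeasure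
  have hC0 : 0 ≤ C := (hC 0).nonneg
  have hr0 : 0 ≤ r := (norm_nonneg w).trans hr
  have hmono : (α.prod α).real (closePairs k ‖w‖) ≤ (α.prod α).real (closePairs k r) :=
    measureReal_mono (fun a ⟨j, hj⟩ => ⟨j, hj.trans hr⟩) (measure_ne_top _ _)
  have hE : 2 * C * ‖w‖ * (α.prod α).real (closePairs k ‖w‖)
      ≤ 2 * C * r * (α.prod α).real (closePairs k r) := by gcongr
  have h1 : ∀ i, shiftLoss p α i w ≤ shiftedSign p α i (w i) + drift p α i w
      + 2 * C * r * (α.prod α).real (closePairs k r) := fun i => by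
    have := (abs_le.1 (abs_shiftLoss_sub_le (α := α) hp (hC i) w)).2
    linarith
  have h2 : ∀ i, shiftLoss p α i (-w) ≤ -shiftedSign p α i (w i) + drift p α i (-w)
      + 2 * C * r * (α.prod α).real (closePairs k r) := fun i => by
    have := (abs_le.1 (abs_shiftLoss_sub_le (α := α) hp (hC i) (-w))).2
    rw [norm_neg, Pi.neg_apply, shiftedSign_neg] at this
    linarith
  have h3 : ∀ i, drift p α i (-w) ≤ -drift p α i w + C * r * r := fun i => by
    have := (abs_le.1 (abs_drift_add_sub_le (α := α) hp (hC i) w (-w))).1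
    rw [add_neg_cancel, drift_zero, norm_neg] at this
    have : C * ‖w‖ * ‖w‖ ≤ C * r * r := by gcongr
    linarith
  -- Neither `w` nor `-w` is profitable; since the leading part is odd up to `C * r * r`, this
  -- bounds it on both sides.
  have n1 := (hα.sum_shiftLoss_nonneg hp hw).trans (Finset.sum_le_sum fun i _ => h1 i)
  have n2 := (hα.sum_shiftLoss_nonneg hp (w := -w) (by simp [hw])).trans
    (Finset.sum_le_sum fun i _ => h2 i)
  have n3 := Finset.sum_le_sum fun i (_ : i ∈ Finset.univ) => h3 i
  simp only [Finset.sum_add_distrib, Finset.sum_neg_distrib, Finset.sum_const, Finset.card_univ,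
    Fintype.card_fin, nsmul_eq_mul] at n1 n2 n3
  have hk : 0 ≤ (k : ℝ) * (C * r * r) := by positivity
  rw [abs_le]
  constructor <;> linarith

/-! ### Three coordinates and the dyadic recursion -/

/-- The vector with three prescribed coordinates and zeros elsewhere. -/
def tripleVector {k : ℕ} (a b c : Fin k) (r s t : ℝ) : Fin k → ℝ :=
  fun i => if i = a then r else if i = b then s else if i = c then t else 0

lemma sum_tripleVector {k : ℕ} {a b c : Fin k} (hab : a ≠ b) (hac : a ≠ c) (hbc : b ≠ c)
    (r s t : ℝ) {g : Fin k → ℝ → ℝ} (hg : ∀ i, g i 0 = 0) :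
    ∑ i, g i (tripleVector a b c r s t i) = g a r + g b s + g c t := by
  rw [← Finset.sum_subset (Finset.subset_univ {a, b, c})]
  · rw [Finset.sum_insert (by simp [hab, hac]), Finset.sum_insert (by simp [hbc]),
      Finset.sum_singleton]
    simp [tripleVector, hab.symm, hac.symm, hbc.symm, add_assoc]
  · intro i _ hi
    simp only [Finset.mem_insert, Finset.mem_singleton, not_or] at hi
    simp [tripleVector, hi.1, hi.2.1, hi.2.2, hg]

lemma norm_tripleVector_le {k : ℕ} (a b c : Fin k) {r s t ρ : ℝ} (hr : |r| ≤ ρ) (hs : |s| ≤ ρ)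
    (ht : |t| ≤ ρ) : ‖tripleVector a b c r s t‖ ≤ ρ := by
  have hρ := (abs_nonneg r).trans hr
  refine (pi_norm_le_iff_of_nonneg hρ).2 fun i => ?_
  unfold tripleVector
  split_ifs <;> simpa

lemma tripleVector_add {k : ℕ} (a b c : Fin k) (r s t r' s' t' : ℝ) :
    tripleVector a b c r s t + tripleVector a b c r' s' t'
      = tripleVector a b c (r + r') (s + s') (t + t') := by
  ext i
  simp only [tripleVector, Pi.add_apply]
  split_ifs <;> simp

lemma exists_ne_ne {k : ℕ} (hk : 3 ≤ k) (a : Fin k) : ∃ b c : Fin k, a ≠ b ∧ a ≠ c ∧ b ≠ c := by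
  have h : 2 < (Finset.univ : Finset (Fin k)).card := by
    rw [Finset.card_univ, Fintype.card_fin]; omega
  obtain ⟨b, hb⟩ := Finset.exists_mem_notMem_of_card_lt_card (s := {a}) (t := Finset.univ)
    (by simp; omega)
  obtain ⟨c, hc⟩ := Finset.exists_mem_notMem_of_card_lt_card (s := {a, b}) (t := Finset.univ)
    (Finset.card_le_two.trans_lt h)
  simp only [Finset.mem_insert, Finset.mem_singleton, not_or] at hb hc
  exact ⟨b, c, Ne.symm hb.2, Ne.symm hc.2.1, Ne.symm hc.2.2⟩

/-- With at least three coordinates available the first-order terms cancel, so that the weighted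
mass near the diagonal is almost linear in the scale. -/
lemma IsOptimal.two_mul_shiftedSign_le {k : ℕ} [NeZero k] (hk : 3 ≤ k) {p : Fin k → ℝ}
    (hp : ∀ i, 0 < p i) {α : Measure (Fin k → ℝ)} (hα : IsOptimal p α) {C : ℝ}
    (hC : ∀ i, SecondDifferenceBound (fun (_ : Unit) m => maximizerProb p i m) C) (a : Fin k)
    {t : ℝ} (ht : 0 < t) :
    2 * shiftedSign p α a t ≤ shiftedSign p α a (2 * t)
      + 16 * k * C * t * ((α.prod α).real (closePairs k (2 * t)) + t) := by
  have := hα.isMixedStrategy.isProbabilityMeasure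
  have hC0 : 0 ≤ C := (hC 0).nonneg
  obtain ⟨b, c, hab, hac, hbc⟩ := exists_ne_ne hk a
  -- In `E₁ + E₂ - E₃` the terms at `b` and `c` cancel and the drifts leave only their additivity
  -- defect.
  set w₁ := tripleVector a b c t (-t) 0
  set w₂ := tripleVector a b c t 0 (-t)
  have h12 : w₁ + w₂ = tripleVector a b c (2 * t) (-t) (-t) := by
    rw [tripleVector_add]; congr 1 <;> ring
  have abs_t : |t| ≤ 2 * t := by rw [abs_of_pos ht]; linarith
  have abs_nt : |-t| ≤ 2 * t := by rwa [abs_neg]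
  have abs_2t : |2 * t| ≤ 2 * t := (abs_of_pos (by linarith)).le
  have abs_0 : |(0 : ℝ)| ≤ 2 * t := by simp; linarith
  have n₁ : ‖w₁‖ ≤ 2 * t := norm_tripleVector_le a b c abs_t abs_nt abs_0
  have n₂ : ‖w₂‖ ≤ 2 * t := norm_tripleVector_le a b c abs_t abs_0 abs_nt
  have hsum : ∀ r s u : ℝ, r + s + u = 0 → ∑ i, tripleVector a b c r s u i = 0 :=
    fun r s u h => by
      rw [sum_tripleVector hab hac hbc r s u (g := fun _ v => v) fun _ => rfl, h]
  have E₁ := (abs_le.1 (hα.abs_sum_shiftedSign_add_drift_le hp hC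
    (hsum t (-t) 0 (by ring)) n₁)).2
  have E₂ := (abs_le.1 (hα.abs_sum_shiftedSign_add_drift_le hp hC
    (hsum t 0 (-t) (by ring)) n₂)).2
  have E₃ := (abs_le.1 (hα.abs_sum_shiftedSign_add_drift_le hp hC
    (hsum (2 * t) (-t) (-t) (by ring)) (norm_tripleVector_le a b c abs_2t abs_nt abs_nt))).1
  have hz : ∀ i, shiftedSign p α i 0 = 0 := shiftedSign_zero
  rw [sum_tripleVector hab hac hbc _ _ _ hz, hz] at E₁ E₂
  rw [sum_tripleVector hab hac hbc _ _ _ hz, ← h12] at E₃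
  have hD : ∑ i, drift p α i (w₁ + w₂) - ∑ i, drift p α i w₁ - ∑ i, drift p α i w₂
      ≤ k * (C * (2 * t) * (2 * t)) := by
    rw [← Finset.sum_sub_distrib, ← Finset.sum_sub_distrib]
    refine (Finset.sum_le_card_nsmul _ _ (C * (2 * t) * (2 * t)) fun i _ => ?_).trans (by simp)
    refine (le_abs_self _).trans ((abs_drift_add_sub_le hp (hC i) w₁ w₂).trans ?_)
    gcongr
  -- The errors total `12kCt` times the close-pair probability plus `(12 + 4)kCt²`; `hQ` rounds the
  -- first coefficient up to 16.
  have hQ : 0 ≤ (k : ℝ) * C * t * (α.prod α).real (closePairs k (2 * t)) := by positivity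
  linarith

/-- Halving the scale multiplies `2^n S(2^{-n}) + 1` by at most `1 + L t ≤ exp(L t)` with `t =
2^{-(n+1)}`. These `t` sum to at most 1, so the product stays below `exp L`; the added 1 absorbs the
inhomogeneous term. -/
lemma exists_le_mul_half_pow {S : ℝ → ℝ} {L : ℝ} (hL : 0 ≤ L) (h0 : ∀ t, 0 < t → 0 ≤ S t)
    (h : ∀ t, 0 < t → 2 * S t ≤ S (2 * t) + L * t * (S (2 * t) + t)) :
    ∃ B, ∀ n : ℕ, S ((1 / 2) ^ n) ≤ B * (1 / 2) ^ n := by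
  have key : ∀ n : ℕ, 2 ^ n * S ((1 / 2) ^ n) + 1
      ≤ (S 1 + 1) * Real.exp (L * (1 - (1 / 2) ^ n)) := by
    intro n
    induction n with
    | zero => simp
    | succ n ih =>
      set t : ℝ := (1 / 2) ^ (n + 1) with ht
      have htpos : 0 < t := by positivity
      have h2t : (1 / 2 : ℝ) ^ n = 2 * t := by rw [ht, pow_succ]; ring
      have hpow : (2 : ℝ) ^ n * (2 * t) = 1 := by
        rw [← h2t, ← mul_pow]; norm_num
      rw [h2t] at ih
      have hS := h0 (2 * t) (by positivity)
      calc 2 ^ (n + 1) * S t + 1 = 2 ^ n * (2 * S t) + 1 := by ring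
        _ ≤ 2 ^ n * (S (2 * t) + L * t * (S (2 * t) + t)) + 1 := by gcongr; exact h t htpos
        _ = (2 ^ n * S (2 * t) + 1) * (1 + L * t) - L * t / 2 := by
            linear_combination (L * t / 2) * hpow
        _ ≤ (2 ^ n * S (2 * t) + 1) * (1 + L * t) := by
            have : 0 ≤ L * t := by positivity
            linarith
        _ ≤ ((S 1 + 1) * Real.exp (L * (1 - 2 * t))) * Real.exp (L * t) := by
            have hx := Real.add_one_le_exp (L * t)
            have : 0 ≤ L * t := by positivity
            have := h0 1 one_pos
            exact mul_le_mul ih (by linarith) (by positivity) (by positivity)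
        _ = _ := by
            rw [mul_assoc, ← Real.exp_add]
            ring_nf
  have h1 := h0 1 one_pos
  refine ⟨(S 1 + 1) * Real.exp L, fun n => ?_⟩
  have hexp : Real.exp (L * (1 - (1 / 2) ^ n)) ≤ Real.exp L := by
    apply Real.exp_le_exp.2
    have : 0 ≤ L * (1 / 2) ^ n := by positivity
    linarith
  have hle : 2 ^ n * S ((1 / 2) ^ n) ≤ (S 1 + 1) * Real.exp L := by
    have := key n
    have : (S 1 + 1) * Real.exp (L * (1 - (1 / 2) ^ n)) ≤ (S 1 + 1) * Real.exp L := by gcongr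
    linarith
  calc S ((1 / 2) ^ n) = (2 ^ n * S ((1 / 2) ^ n)) * (1 / 2) ^ n := by
        rw [mul_right_comm, ← mul_pow]; norm_num
    _ ≤ _ := by gcongr

/-- Under an optimal strategy, two independent draws have close `i`-th coordinates with probability
at most linear in the distance. -/
lemma IsOptimal.exists_measureReal_close_le {k : ℕ} (hk : 3 ≤ k) {p : Fin k → ℝ}
    (hp : ∀ i, 0 < p i) (hsum : ∑ i, p i = 1) {α : Measure (Fin k → ℝ)} (hα : IsOptimal p α)
    (i : Fin k) : ∃ B, ∀ n : ℕ,
      (α.prod α).real {a | |a.1 i - a.2 i| ≤ (1 / 2) ^ n} ≤ B * (1 / 2) ^ n := by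
  have := hα.isMixedStrategy.isProbabilityMeasure
  have : NeZero k := ⟨by omega⟩
  obtain ⟨R, hR⟩ := hα.exists_ae_norm_le hp hsum
  obtain ⟨c, hc, hcR⟩ := exists_pos_le_maximizerProb hp R
  choose C' hC' using fun i => exists_secondDifferenceBound_maximizerProb hp i
  set C := ∑ i, C' i
  have hC : ∀ i, SecondDifferenceBound (fun (_ : Unit) m => maximizerProb p i m) C := fun i =>
    (hC' i).mono (Finset.single_le_sum (fun j _ => (hC' j).nonneg) (Finset.mem_univ i))
  have hC0 : 0 ≤ C := (hC 0).nonneg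
  have hP : ∀ j t, 0 < t →
      c * (α.prod α).real {a | |a.1 j - a.2 j| ≤ t} ≤ 2 * shiftedSign p α j t :=
    fun j t ht => mul_measureReal_le_shiftedSign hp hcR hR j ht
  have hS0 : ∀ j t, 0 < t → 0 ≤ shiftedSign p α j t := fun j t ht => by
    have h1 := hP j t ht
    have h2 : 0 ≤ c * (α.prod α).real {a | |a.1 j - a.2 j| ≤ t} := by positivity
    linarith
  have hQ : ∀ t, 0 < t → (α.prod α).real (closePairs k t)
      ≤ 2 / c * ∑ j, shiftedSign p α j t := fun t ht => by
    refine (measureReal_closePairs_le t).trans ?_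
    rw [Finset.mul_sum]
    refine Finset.sum_le_sum fun j _ => ?_
    rw [div_mul_eq_mul_div, le_div_iff₀ hc, mul_comm]
    exact hP j t ht
  set M := 2 / c + 1
  have hM : 0 ≤ M := by positivity
  -- A close pair may be close in any coordinate, so the recursion closes only for the sum over all
  -- `j`; the outer `k` in `L` counts its summands.
  obtain ⟨B, hB⟩ := exists_le_mul_half_pow (S := fun t => ∑ j, shiftedSign p α j t)
    (L := k * (16 * k * C * M)) (by positivity)
    (fun t ht => Finset.sum_nonneg fun j _ => hS0 j t ht) fun t ht => by
      have hs : 0 ≤ ∑ j, shiftedSign p α j (2 * t) :=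
        Finset.sum_nonneg fun j _ => hS0 j _ (by positivity)
      have hQ' : (α.prod α).real (closePairs k (2 * t)) + t
          ≤ M * (∑ j, shiftedSign p α j (2 * t) + t) := by
        have := hQ (2 * t) (by positivity)
        have h3 : 0 ≤ 2 / c * t := by positivity
        calc _ ≤ 2 / c * ∑ j, shiftedSign p α j (2 * t) + t := by linarith
          _ ≤ 2 / c * ∑ j, shiftedSign p α j (2 * t) + t
              + (2 / c * t + ∑ j, shiftedSign p α j (2 * t)) := by linarith
          _ = _ := by ring
      rw [Finset.mul_sum]
      calc ∑ j, 2 * shiftedSign p α j t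
          ≤ ∑ j, (shiftedSign p α j (2 * t)
            + 16 * k * C * t * (M * (∑ j, shiftedSign p α j (2 * t) + t))) := by
            refine Finset.sum_le_sum fun j _ =>
              (hα.two_mul_shiftedSign_le hk hp hC j ht).trans ?_
            gcongr
        _ = _ := by
            rw [Finset.sum_add_distrib, Finset.sum_const, Finset.card_univ, Fintype.card_fin,
              nsmul_eq_mul]
            ring
  refine ⟨2 / c * B, fun n => ?_⟩
  have hn : (0 : ℝ) < (1 / 2) ^ n := by positivity
  have h1 : shiftedSign p α i ((1 / 2) ^ n) ≤ B * (1 / 2) ^ n :=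
    (Finset.single_le_sum (fun j _ => hS0 j _ hn) (Finset.mem_univ i)).trans (hB n)
  have h2 := hP i _ hn
  rw [mul_assoc, div_mul_eq_mul_div, le_div_iff₀ hc, mul_comm]
  linarith

lemma prod_marginal_dist_le {k : ℕ} (α : Measure (Fin k → ℝ)) [IsProbabilityMeasure α]
    (i : Fin k) (r : ℝ) :
    ((marginal α i).prod (marginal α i)) {q | dist q.1 q.2 ≤ r}
      = (α.prod α) {a | |a.1 i - a.2 i| ≤ r} := by
  have hm : MeasurableSet {q : ℝ × ℝ | dist q.1 q.2 ≤ r} :=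
    measurableSet_le (by fun_prop) measurable_const
  rw [marginal, Measure.map_prod_map _ _ (measurable_pi_apply i) (measurable_pi_apply i),
    Measure.map_apply (by fun_prop) hm]
  rfl

end KnockEmDown

theorem theorem2p5 (k : ℕ) (hk : 3 ≤ k) (p : Fin k → ℝ) (hp : ∀ i, 0 < p i)
    (hsum : ∑ i, p i = 1) (α : Measure (Fin k → ℝ)) (hα : KnockEmDown.IsOptimal p α)
    (i : Fin k) :
    KnockEmDown.marginal α i ≪ volume ∧
      ∃ f : ℝ → ℝ, Measurable f ∧ (∀ t, 0 ≤ f t) ∧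
        KnockEmDown.marginal α i = volume.withDensity (fun t => ENNReal.ofReal (f t)) ∧
        MemLp f 2 volume := by
  have := hα.isMixedStrategy.isProbabilityMeasure
  have : IsProbabilityMeasure (KnockEmDown.marginal α i) :=
    Measure.isProbabilityMeasure_map (measurable_pi_apply i).aemeasurable
  obtain ⟨B, hB⟩ := hα.exists_measureReal_close_le hk hp hsum i
  have h := KnockEmDown.absolutelyContinuous_and_lintegral_rnDeriv_sq_le
    (μ := KnockEmDown.marginal α i) (C := ENNReal.ofReal B) ENNReal.ofReal_ne_top
    -- The radius is half the dyadic scale, since balls of radius `r` detect pairs at distance up to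
    -- `2r`.
    (r := fun n => (1 / 2) ^ n * (1 / 2)) (fun n => by positivity)
    (by simpa only [zero_mul] using (tendsto_pow_atTop_nhds_zero_of_lt_one (r := (1 / 2 : ℝ))
      (by norm_num) (by norm_num)).mul_const (1 / 2))
    fun n => by
      have e : 2 * ((1 / 2 : ℝ) ^ n * (1 / 2)) = (1 / 2) ^ n := by ring
      rw [e, KnockEmDown.prod_marginal_dist_le, ← ofReal_measureReal,
        ← ENNReal.ofReal_mul' (by positivity)]
      exact ENNReal.ofReal_le_ofReal (hB n)
  exact ⟨h.1, KnockEmDown.exists_memLp_two_density h.1 (h.2.trans_lt ENNReal.ofReal_lt_top).ne⟩
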